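/- **Definitions.** For $A\subset\mathbb R^n$ and $j\in\mathbb N$, say that $A$ has *property (iv)* (the fine weak $j$-dimensional approximation property with local $\rho_y$-uniformity) if for every $\delta>0$ and every $y\in A$ there is $\rho_y>0$ such that for all $\rho\in(0,\rho_y]$ and all $x\in B_{\rho_y}(y)$ there is a $j$-dimensional affine space $L_{x,\rho}$ with $B_\rho(x)\cap A\subset L_{x,\rho}^{\delta\rho}$, where $L^{r}$ is the set of points at distance $<r$ from some point of $L$ and $B_\rho(x)$ is the open ball. $A$ has *Simon's approximation property* if for every $\delta>0$ and every $y\in A$ there is $p>0$ such that for all $\sigma\in(0,p]$ and all $z\in A\cap\overline{B_p(y)}$ there is a $j$-dimensional affine space $L_{z,\sigma}$ containing $z$ with $A\cap B_\sigma(z)\subset L_{z,\sigma}^{\delta\sigma}$. $A$ is *locally $\mathcal H^j$-finite* if $\mathcal H^j(K\cap A)<\infty$ for every compact $K$, and *weakly locally $\mathcal H^j$-finite* if for each $y\in A$ there is $\rho_y>0$ with $\mathcal H^j(B_{\rho_y}(y)\cap A)<\infty$. **The set $A_\varepsilon\subset\mathbb R^2$.** Let $A_{0}=A_{0,1}$ be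 the segment from $(0,0)$ to $(1,0)$. Given the polygonal line $A_n$, made of $2^n$ segments $A_{n,1},\dots,A_{n,2^n}$ numbered from left to right, let $T_{n,i}$ be the isosceles triangle with base $A_{n,i}$ and height $2^{1-n}\varepsilon$, where $T_{0,1}$ lies above $A_{0,1}$ and, for $n\ge1$, $T_{n,i}$ lies inside the triangle $T_{n-1,k}$ of which $A_{n,i}$ is an edge; let $a_{n,i}$ be the vertex of $T_{n,i}$ opposite to $A_{n,i}$, let $A_{n+1,2i-1},A_{n+1,2i}$ be the two edges of $T_{n,i}$ at $a_{n,i}$, and let $A_{n+1}$ be the union of all the $A_{n+1,k}$. Put $$A_\varepsilon:=\overline{\bigcup_{n\ge1}A_n}\;\setminus\;\bigcup_{n\ge1}A_n .$$ **The set $\mathcal A_\varepsilon$.** Let $e_1=(0,0)$, $e_2=(1,0)$, and $e_{1+i+2^n}=a_{n,i}$ for $n\ge0$, $1\le i\le 2^n$. Let $\rho_1=\tfrac14 2^{-7}(1+7\cdot16\varepsilon^2)^{1/2}$, $\rho_k=4^{1-k}\rho_1$, $r_1=\rho_1$, $r_2=\rho_2$, and for $k\ge3$ let $r_k=\min\{\rho_k,\tfrac12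 d(e_k,A_{n-1}\cup A_{n-2})\}$, where $n\ge 0$ is the unique integer with $2+\sum_{j=0}^{n}2^j\le k\le 1+\sum_{j=0}^{n+1}2^j$, and where the sets $A_m$ with $m<0$ are left out (so $r_k=\rho_k$ if $n=0$). Put $\mathcal A_\varepsilon:=A_\varepsilon\setminus\bigcup_{k\ge1}B_{r_k}(e_k)$. **Theorem.** Let $0<\varepsilon<1/100$. (a) $A_\varepsilon$ has property (iv) and Simon's approximation property with $j=1$, but $A_\varepsilon$ is not weakly locally $\mathcal H^1$-finite. (b) $\mathcal A_\varepsilon$ is a closed subset of $A_\varepsilon$ that has property (iv) and Simon's approximation property with $j=1$, but it is not weakly locally $\mathcal H^1$-finite. Moreover $\mathcal H^1(\mathcal A_\varepsilon)=\infty$, and there is a point $y\in\mathcal A_\varepsilon$ of infinite density, that is, $\lim_{\rho\to0}\mathcal H^1(\mathcal A_\varepsilon\cap B_\rho(y))/(2\rho)=\infty$. Consequently, the question whether property (iv) implies local $\mathcal H^j$-finiteness has a negative answer, already for subsets of $\mathbb R^2$ and $j=1$: property (iv) implies neither local $\mathcal H^1$-finiteness nor weak local $\mathcal H^1$-finiteness,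 and it implies neither of them for closed sets. -/

import Mathlib

open Set Filter Topology MeasureTheory

noncomputable section

namespace PseudoFractal

/-! ### Approximation properties and local finiteness for subsets of `ℝⁿ` -/

/-- `L` is a `j`-dimensional affine subspace of `ℝⁿ`. -/
def IsAffineOfDim {n : ℕ} (j : ℕ) (L : AffineSubspace ℝ (EuclideanSpace ℝ (Fin n))) : Prop :=
  (L : Set (EuclideanSpace ℝ (Fin n))).Nonempty ∧ Module.finrank ℝ L.direction = j

/-- The weak `j`-dimensional `δ`-approximation property with local `ρ_y`-uniformity.
`Metric.thickening r L` is the set of all points at distance `< r` from some point of `L`. -/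
def WeakApproxLocUnif {n : ℕ} (j : ℕ) (δ : ℝ) (A : Set (EuclideanSpace ℝ (Fin n))) : Prop :=
  ∀ y ∈ A, ∃ ρy : ℝ, 0 < ρy ∧ ∀ ρ : ℝ, 0 < ρ → ρ ≤ ρy → ∀ x ∈ Metric.ball y ρy,
    ∃ L : AffineSubspace ℝ (EuclideanSpace ℝ (Fin n)), IsAffineOfDim j L ∧
      Metric.ball x ρ ∩ A ⊆ Metric.thickening (δ * ρ) (L : Set (EuclideanSpace ℝ (Fin n)))

/-- The fine weak `j`-dimensional approximation property with local `ρ_y`-uniformity: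
the preceding property for every `δ > 0`. -/
def FineWeakApproxLocUnif {n : ℕ} (j : ℕ) (A : Set (EuclideanSpace ℝ (Fin n))) : Prop :=
  ∀ δ : ℝ, 0 < δ → WeakApproxLocUnif j δ A

/-- The approximation property in the form in which it occurs in Simon's lemma: the centres
range over `A` and the affine subspaces pass through the centres. -/
def SimonApprox {n : ℕ} (j : ℕ) (A : Set (EuclideanSpace ℝ (Fin n))) : Prop :=
  ∀ δ : ℝ, 0 < δ → ∀ y ∈ A, ∃ p : ℝ, 0 < p ∧ ∀ σ : ℝ, 0 < σ → σ ≤ p →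
    ∀ z ∈ A ∩ Metric.closedBall y p,
      ∃ L : AffineSubspace ℝ (EuclideanSpace ℝ (Fin n)), IsAffineOfDim j L ∧ z ∈ L ∧
        A ∩ Metric.ball z σ ⊆ Metric.thickening (δ * σ) (L : Set (EuclideanSpace ℝ (Fin n)))

/-- `A` has locally finite `j`-dimensional Hausdorff measure. -/
def LocallyFiniteHausdorff {n : ℕ} (j : ℕ) (A : Set (EuclideanSpace ℝ (Fin n))) : Prop :=
  ∀ K : Set (EuclideanSpace ℝ (Fin n)), IsCompact K → μH[(j : ℝ)] (K ∩ A) < ⊤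

/-- `A` has weak locally finite `j`-dimensional Hausdorff measure. -/
def WeakLocallyFiniteHausdorff {n : ℕ} (j : ℕ) (A : Set (EuclideanSpace ℝ (Fin n))) : Prop :=
  ∀ y ∈ A, ∃ ρy : ℝ, 0 < ρy ∧ μH[(j : ℝ)] (Metric.ball y ρy ∩ A) < ⊤

/-- The `1`-dimensional density of `A` at `x` with respect to `ℋ¹` exists and equals `θ`
(the unit ball of `ℝ¹` has length `2`). -/
def HasOneDensity {n : ℕ} (A : Set (EuclideanSpace ℝ (Fin n))) (x : EuclideanSpace ℝ (Fin n))
    (θ : ENNReal) : Prop :=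
  Tendsto (fun ρ : ℝ => μH[1] (A ∩ Metric.ball x ρ) / ENNReal.ofReal (2 * ρ)) (𝓝[>] 0) (𝓝 θ)

/-! ### The construction of the pseudo-fractal set -/

/-- Rotation of the plane by a right angle, counterclockwise. -/
def rot (v : EuclideanSpace ℝ (Fin 2)) : EuclideanSpace ℝ (Fin 2) := !₂[-v 1, v 0]

/-- The new vertex of the triangular cap of (signed) height `h` over the segment from `p` to `q`:
it lies at distance `|h|` from the midpoint, orthogonally to the segment, to the left of the
direction from `p` to `q` if `h > 0` and to the right of it if `h < 0`. -/
def capVertex (h : ℝ) (p q : EuclideanSpace ℝ (Fin 2)) : EuclideanSpace ℝ (Fin 2) :=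
  midpoint ℝ p q + (h / ‖q - p‖) • rot (q - p)

/-- The signed height of the caps of level `n`. The heights are `2ε, ε, ε/2, …`. The cap of level
`0` points upwards, and every later cap over an edge of a cap `T` lies inside `T`. As edges are
directed from left to right, this means that the side alternates with the level (see
`cap_left_subset` and `cap_right_subset` below). -/
def capHeight (ε : ℝ) (n : ℕ) : ℝ := (-1) ^ n * (2 * ε / 2 ^ n)

/-- The pair of left and right endpoints of the segment `A_{n,i}`, where `0 ≤ i < 2 ^ n`
(the index `i` is counted from `0`, from left to right). The segments of level `n + 1` over
`A_{n,i}` are the two new edges of the cap over `A_{n,i}`. -/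
def edge (ε : ℝ) : ℕ → ℕ → EuclideanSpace ℝ (Fin 2) × EuclideanSpace ℝ (Fin 2)
  | 0, _ => (!₂[0, 0], !₂[1, 0])
  | n + 1, i =>
    let e := edge ε n (i / 2)
    let a := capVertex (capHeight ε n) e.1 e.2
    if i % 2 = 0 then (e.1, a) else (a, e.2)

/-- The vertex `a_{n,i}` of the cap `T_{n,i}` that is not on its base `A_{n,i}`. -/
def apex (ε : ℝ) (n i : ℕ) : EuclideanSpace ℝ (Fin 2) :=
  capVertex (capHeight ε n) (edge ε n i).1 (edge ε n i).2

/-- The triangular cap `T_{n,i}` (a filled triangle) over `A_{n,i}`. -/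
def cap (ε : ℝ) (n i : ℕ) : Set (EuclideanSpace ℝ (Fin 2)) :=
  convexHull ℝ {(edge ε n i).1, (edge ε n i).2, apex ε n i}

/-- The polygonal line `A_n`, the union of the `2 ^ n` segments `A_{n,i}`. -/
def stage (ε : ℝ) (n : ℕ) : Set (EuclideanSpace ℝ (Fin 2)) :=
  ⋃ i ∈ Finset.range (2 ^ n), segment ℝ (edge ε n i).1 (edge ε n i).2

/-- The pseudo-fractal set `A_ε`. -/
def pseudoFractal (ε : ℝ) : Set (EuclideanSpace ℝ (Fin 2)) :=
  closure (⋃ n ∈ Ici 1, stage ε n) \ ⋃ n ∈ Ici 1, stage ε n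

/-! ### The closed subset -/

/-- The enumeration `e_1, e_2, …` of all edge points: `e_1 = (0,0)`, `e_2 = (1,0)`, and then the
vertices `a_{n,i}`, level by level and from left to right. With `i` counted from `0`, the vertex
`a_{n,i}` is `e_k` for `k = 2 + (2 ^ n + i)`. The index `k = 0` is not used. -/
def edgePoint (ε : ℝ) (k : ℕ) : EuclideanSpace ℝ (Fin 2) :=
  if k ≤ 1 then !₂[0, 0]
  else if k = 2 then !₂[1, 0]
  else apex ε (Nat.log 2 (k - 2)) (k - 2 - 2 ^ Nat.log 2 (k - 2))

/-- `ρ_1 = (1/4) 2⁻⁷ (1 + 7 · 16 ε²)^{1/2}` and `ρ_k = 4^{1-k} ρ_1` for `k ≥ 1`. -/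
def rho (ε : ℝ) (k : ℕ) : ℝ :=
  (4 : ℝ) ^ (1 - (k : ℤ)) * (1 / 4 * (1 / 2 ^ 7) * √(1 + 7 * 16 * ε ^ 2))

/-- For `k ≥ 3`, the unique `n` with `2 + ∑_{j ≤ n} 2^j ≤ k ≤ 1 + ∑_{j ≤ n + 1} 2^j`
(see `block_spec` below). -/
def block (k : ℕ) : ℕ := Nat.log 2 (k - 1) - 1

/-- `A_{n-1} ∪ A_{n-2}`, where there is no contribution of negative indices. -/
def prevStages (ε : ℝ) (n : ℕ) : Set (EuclideanSpace ℝ (Fin 2)) :=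
  ⋃ m ∈ {m : ℕ | m + 1 = n ∨ m + 2 = n}, stage ε m

/-- The radii `r_k`: `r_1 = ρ_1`, `r_2 = ρ_2`, and for `k ≥ 3`, with `n` as in `block`, `r_k` is the
minimum of `ρ_k` and of half the distance of `e_k` from `A_{n-1} ∪ A_{n-2}`; for `n = 0` this
union is empty, and `r_k = ρ_k`. -/
def radius (ε : ℝ) (k : ℕ) : ℝ :=
  if k ≤ 2 ∨ block k = 0 then rho ε k
  else min (rho ε k) (Metric.infDist (edgePoint ε k) (prevStages ε (block k)) / 2)

/-- The closed subset of `A_ε`: small open balls around all edge points are removed. -/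
def closedPseudoFractal (ε : ℝ) : Set (EuclideanSpace ℝ (Fin 2)) :=
  pseudoFractal ε \ ⋃ k ∈ Ici 1, Metric.ball (edgePoint ε k) (radius ε k)

/-! ### The indices and sides in the definitions are the right ones -/

theorem block_spec (k : ℕ) (hk : 3 ≤ k) (n : ℕ) :
    block k = n ↔ 2 + ∑ j ∈ Finset.range (n + 1), 2 ^ j ≤ k ∧
      k ≤ 1 + ∑ j ∈ Finset.range (n + 2), 2 ^ j := by
  have h1 : ∀ m : ℕ, ∑ j ∈ Finset.range m, 2 ^ j + 1 = 2 ^ m := fun m => by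
    have := Nat.geomSum_eq (le_refl 2) m
    have h2 := Nat.one_le_two_pow (n := m)
    simp at this
    omega
  have h2 := h1 (n + 1)
  have h3 := h1 (n + 2)
  have hl : 1 ≤ Nat.log 2 (k - 1) := Nat.log_pos (by norm_num) (by omega)
  have : block k = n ↔ Nat.log 2 (k - 1) = n + 1 := by unfold block; omega
  rw [this, Nat.log_eq_iff (by left; omega)]
  have h4 : n + 1 + 1 = n + 2 := rfl
  rw [h4]
  omega

theorem edgePoint_apex (ε : ℝ) (n i : ℕ) (hi : i < 2 ^ n) :
    edgePoint ε (2 + (2 ^ n + i)) = apex ε n i := by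
  have h0 : 0 < 2 ^ n := by positivity
  have hl : Nat.log 2 (2 ^ n + i) = n := by
    rw [Nat.log_eq_iff (by right; omega)]
    exact ⟨by omega, by rw [pow_succ]; omega⟩
  unfold edgePoint
  rw [if_neg (by omega), if_neg (by omega)]
  have : 2 + (2 ^ n + i) - 2 = 2 ^ n + i := by omega
  rw [this, hl]
  congr 1
  omega

theorem norm_capVertex_sub_left (h : ℝ) (p q : EuclideanSpace ℝ (Fin 2)) (hpq : 0 < ‖q - p‖) :
    ‖capVertex h p q - p‖ ^ 2 = ‖q - p‖ ^ 2 / 4 + h ^ 2 := by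
  have hL : ‖q - p‖ ^ 2 = (q 0 - p 0) ^ 2 + (q 1 - p 1) ^ 2 := by
    simp [EuclideanSpace.norm_sq_eq, Fin.sum_univ_two]
  have hL0 := hpq.ne'
  have e0 : (capVertex h p q - p) 0 = (q 0 - p 0) / 2 - h / ‖q - p‖ * (q 1 - p 1) := by
    simp [capVertex, rot, midpoint_eq_smul_add]; ring
  have e1 : (capVertex h p q - p) 1 = (q 1 - p 1) / 2 + h / ‖q - p‖ * (q 0 - p 0) := by
    simp [capVertex, rot, midpoint_eq_smul_add]; ring
  rw [EuclideanSpace.norm_sq_eq, Fin.sum_univ_two, e0, e1]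
  simp only [Real.norm_eq_abs, sq_abs]
  have : h ^ 2 = (h / ‖q - p‖) ^ 2 * ‖q - p‖ ^ 2 := by field_simp
  rw [this, hL]; ring

theorem norm_sub_capVertex_right (h : ℝ) (p q : EuclideanSpace ℝ (Fin 2)) (hpq : 0 < ‖q - p‖) :
    ‖q - capVertex h p q‖ ^ 2 = ‖q - p‖ ^ 2 / 4 + h ^ 2 := by
  have hL : ‖q - p‖ ^ 2 = (q 0 - p 0) ^ 2 + (q 1 - p 1) ^ 2 := by
    simp [EuclideanSpace.norm_sq_eq, Fin.sum_univ_two]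
  have hL0 := hpq.ne'
  have e0 : (q - capVertex h p q) 0 = (q 0 - p 0) / 2 + h / ‖q - p‖ * (q 1 - p 1) := by
    simp [capVertex, rot, midpoint_eq_smul_add]; ring
  have e1 : (q - capVertex h p q) 1 = (q 1 - p 1) / 2 - h / ‖q - p‖ * (q 0 - p 0) := by
    simp [capVertex, rot, midpoint_eq_smul_add]; ring
  rw [EuclideanSpace.norm_sq_eq, Fin.sum_univ_two, e0, e1]
  simp only [Real.norm_eq_abs, sq_abs]
  have : h ^ 2 = (h / ‖q - p‖) ^ 2 * ‖q - p‖ ^ 2 := by field_simp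
  rw [this, hL]; ring

theorem edge_succ_even (ε : ℝ) (n i : ℕ) :
    edge ε (n + 1) (2 * i) = ((edge ε n i).1, apex ε n i) := by
  have : 2 * i / 2 = i := by omega
  simp [edge, apex, this]

theorem edge_succ_odd (ε : ℝ) (n i : ℕ) :
    edge ε (n + 1) (2 * i + 1) = (apex ε n i, (edge ε n i).2) := by
  have h1 : (2 * i + 1) / 2 = i := by omega
  have h2 : (2 * i + 1) % 2 = 1 := by omega
  simp [edge, apex, h1, h2]

/-- The length of the segments of level `n` is `(1 + 16 n ε²)^{1/2} / 2^n`. -/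
theorem edge_length_sq (ε : ℝ) (n i : ℕ) :
    ‖(edge ε n i).2 - (edge ε n i).1‖ ^ 2 = (1 + n * (16 * ε ^ 2)) / 4 ^ n := by
  induction n generalizing i with
  | zero => simp [edge, EuclideanSpace.norm_sq_eq, Fin.sum_univ_two]
  | succ n ih =>
    have hp : ∀ j, 0 < ‖(edge ε n j).2 - (edge ε n j).1‖ := fun j => by
      have h1 : 0 < ‖(edge ε n j).2 - (edge ε n j).1‖ ^ 2 := by rw [ih]; positivity
      exact lt_of_le_of_ne (norm_nonneg _) (fun h' => by rw [← h'] at h1; simp at h1)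
    have hh : capHeight ε n ^ 2 = 4 * ε ^ 2 / 4 ^ n := by
      have h4 : (4 : ℝ) ^ n = (2 ^ n) ^ 2 := by rw [← pow_mul, mul_comm, pow_mul]; norm_num
      rw [capHeight, mul_pow, ← pow_mul, mul_comm n 2, pow_mul, h4]
      norm_num
      ring
    obtain ⟨j, rfl | rfl⟩ := Nat.even_or_odd' i
    · rw [edge_succ_even]
      simp only [apex]
      rw [norm_capVertex_sub_left _ _ _ (hp j), ih, hh]
      push_cast
      field_simp
      ring
    · rw [edge_succ_odd]
      simp only [apex]
      rw [norm_sub_capVertex_right _ _ _ (hp j), ih, hh]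
      push_cast
      field_simp
      ring

theorem mem_triangle {p q r x : EuclideanSpace ℝ (Fin 2)} (a b c : ℝ) (ha : 0 ≤ a) (hb : 0 ≤ b)
    (hc : 0 ≤ c) (habc : a + b + c = 1) (hx : x = a • p + b • q + c • r) :
    x ∈ convexHull ℝ {p, q, r} := by
  have h := (convex_convexHull ℝ {p, q, r}).sum_mem (t := Finset.univ) (w := ![a, b, c])
    (z := ![p, q, r]) (by intro i _; fin_cases i <;> simpa)
    (by simp [Fin.sum_univ_three, habc])
    (by intro i _; apply subset_convexHull; fin_cases i <;> simp)
  simpa [Fin.sum_univ_three, hx] using h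

theorem cap_coeff {h L l : ℝ} (hL : 0 < L) (hl : 0 < l) (hll : l ^ 2 = L ^ 2 / 4 + h ^ 2)
    (hh : |h| ≤ L) : L / (4 * l) ≤ 1 / 2 ∧ h ^ 2 / (2 * l * L) ≤ 1 / 2 := by
  have h1 : L ≤ 2 * l := by nlinarith [sq_nonneg h]
  have h2 : |h| ≤ l := abs_le_of_sq_le_sq (by nlinarith [sq_nonneg L]) hl.le
  have h3 : h ^ 2 ≤ l * L := by
    rw [← sq_abs, sq]; exact mul_le_mul h2 hh (abs_nonneg _) hl.le
  constructor
  · rw [div_le_div_iff₀ (by positivity) (by norm_num)]; linarith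
  · rw [div_le_div_iff₀ (by positivity) (by norm_num)]; linarith

theorem capVertex_left_mem (h : ℝ) (p q : EuclideanSpace ℝ (Fin 2)) (hpq : 0 < ‖q - p‖)
    (h0 : h ≠ 0) (hh : |h| ≤ ‖q - p‖) :
    capVertex (-(h / 2)) p (capVertex h p q) ∈ convexHull ℝ {p, q, capVertex h p q} := by
  have hll := norm_capVertex_sub_left h p q hpq
  have hl0 : 0 < ‖capVertex h p q - p‖ :=
    lt_of_le_of_ne (norm_nonneg _) (fun h' => by rw [← h'] at hll; nlinarith [sq_nonneg h])
  obtain ⟨h1, h2⟩ := cap_coeff hpq hl0 hll hh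
  have h3 : 0 < ‖q - p‖ / (4 * ‖capVertex h p q - p‖) := by positivity
  have h4 : 0 ≤ h ^ 2 / (2 * ‖capVertex h p q - p‖ * ‖q - p‖) := by positivity
  refine mem_triangle
    (1 / 2 + ‖q - p‖ / (4 * ‖capVertex h p q - p‖) / 2 -
      h ^ 2 / (2 * ‖capVertex h p q - p‖ * ‖q - p‖))
    (‖q - p‖ / (4 * ‖capVertex h p q - p‖) / 2 + h ^ 2 / (2 * ‖capVertex h p q - p‖ * ‖q - p‖))
    (1 / 2 - ‖q - p‖ / (4 * ‖capVertex h p q - p‖))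
    (by linarith) (by linarith) (by linarith) (by ring) ?_
  rw [capVertex]
  generalize ‖capVertex h p q - p‖ = l at *
  have hL : ‖q - p‖ ≠ 0 := hpq.ne'
  ext i
  fin_cases i <;> simp [capVertex, rot, midpoint_eq_smul_add] <;> field_simp <;> ring

theorem capVertex_right_mem (h : ℝ) (p q : EuclideanSpace ℝ (Fin 2)) (hpq : 0 < ‖q - p‖)
    (h0 : h ≠ 0) (hh : |h| ≤ ‖q - p‖) :
    capVertex (-(h / 2)) (capVertex h p q) q ∈ convexHull ℝ {p, q, capVertex h p q} := by
  have hll := norm_sub_capVertex_right h p q hpq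
  have hl0 : 0 < ‖q - capVertex h p q‖ :=
    lt_of_le_of_ne (norm_nonneg _) (fun h' => by rw [← h'] at hll; nlinarith [sq_nonneg h])
  obtain ⟨h1, h2⟩ := cap_coeff hpq hl0 hll hh
  have h3 : 0 < ‖q - p‖ / (4 * ‖q - capVertex h p q‖) := by positivity
  have h4 : 0 ≤ h ^ 2 / (2 * ‖q - capVertex h p q‖ * ‖q - p‖) := by positivity
  refine mem_triangle
    (‖q - p‖ / (4 * ‖q - capVertex h p q‖) / 2 + h ^ 2 / (2 * ‖q - capVertex h p q‖ * ‖q - p‖))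
    (1 / 2 + ‖q - p‖ / (4 * ‖q - capVertex h p q‖) / 2 -
      h ^ 2 / (2 * ‖q - capVertex h p q‖ * ‖q - p‖))
    (1 / 2 - ‖q - p‖ / (4 * ‖q - capVertex h p q‖))
    (by linarith) (by linarith) (by linarith) (by ring) ?_
  rw [capVertex]
  generalize ‖q - capVertex h p q‖ = l at *
  have hL : ‖q - p‖ ≠ 0 := hpq.ne'
  ext i
  fin_cases i <;> simp [capVertex, rot, midpoint_eq_smul_add] <;> field_simp <;> ring

theorem capHeight_succ (ε : ℝ) (n : ℕ) : capHeight ε (n + 1) = -(capHeight ε n / 2) := by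
  simp only [capHeight, pow_succ]; field_simp

theorem edge_pos_and_height_le (ε : ℝ) (h0 : 0 < ε) (h1 : ε < 1 / 100) (n i : ℕ) :
    0 < ‖(edge ε n i).2 - (edge ε n i).1‖ ∧ capHeight ε n ≠ 0 ∧
      |capHeight ε n| ≤ ‖(edge ε n i).2 - (edge ε n i).1‖ := by
  have h := edge_length_sq ε n i
  have hh : capHeight ε n ^ 2 = 4 * ε ^ 2 / 4 ^ n := by
    have h4 : (4 : ℝ) ^ n = (2 ^ n) ^ 2 := by rw [← pow_mul, mul_comm, pow_mul]; norm_num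
    rw [capHeight, mul_pow, ← pow_mul, mul_comm n 2, pow_mul, h4]
    norm_num
    ring
  have h2 : (0 : ℝ) < (1 + n * (16 * ε ^ 2)) / 4 ^ n := by positivity
  refine ⟨lt_of_le_of_ne (norm_nonneg _) (fun h' => by rw [← h'] at h; simp at h; linarith), ?_, ?_⟩
  · intro h'
    rw [h'] at hh
    have : 0 < 4 * ε ^ 2 / 4 ^ n := by positivity
    simp at hh
    linarith
  · refine abs_le_of_sq_le_sq ?_ (norm_nonneg _)
    rw [h, hh]
    gcongr
    have : (0 : ℝ) ≤ n * (16 * ε ^ 2) := by positivity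
    nlinarith

/-- Every cap over an edge of a cap `T` is contained in `T`. -/
theorem cap_left_subset (ε : ℝ) (h0 : 0 < ε) (h1 : ε < 1 / 100) (n i : ℕ) :
    cap ε (n + 1) (2 * i) ⊆ cap ε n i := by
  obtain ⟨hp, hn, hh⟩ := edge_pos_and_height_le ε h0 h1 n i
  refine convexHull_min ?_ (convex_convexHull ℝ _)
  rintro x (rfl | rfl | rfl)
  · rw [edge_succ_even]; exact subset_convexHull _ _ (by simp)
  · rw [edge_succ_even]; exact subset_convexHull _ _ (by simp)
  · rw [apex, edge_succ_even, capHeight_succ]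
    exact capVertex_left_mem _ _ _ hp hn hh

theorem cap_right_subset (ε : ℝ) (h0 : 0 < ε) (h1 : ε < 1 / 100) (n i : ℕ) :
    cap ε (n + 1) (2 * i + 1) ⊆ cap ε n i := by
  obtain ⟨hp, hn, hh⟩ := edge_pos_and_height_le ε h0 h1 n i
  refine convexHull_min ?_ (convex_convexHull ℝ _)
  rintro x (rfl | rfl | rfl)
  · rw [edge_succ_odd]; exact subset_convexHull _ _ (by simp)
  · rw [edge_succ_odd]; exact subset_convexHull _ _ (by simp)
  · rw [apex, edge_succ_odd, capHeight_succ]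
    exact capVertex_right_mem _ _ _ hp hn hh

end PseudoFractal

end

/-!
The polygonal lines `A_n` have length `(1 + 16 n ε²)^{1/2}`, which tends to infinity, while the
ratio of height and base of the caps of level `n` (`slope`) tends to zero. The first fact makes the
limit set infinitely long everywhere, the second one makes it flat at small scales, although the
sum of the angles diverges.

Let `K = piece ε 0 0` be the closure of the set of all vertices, the limit curve. It is the union of
the pieces of any level, a piece is contained in its cap, and different caps of the same level meet
only in common vertices (`isEndpoint_of_mem_caps`). All of this comes from one computation in a
frame adapted to a segment (`left_child_frame`): the two caps over the edges of a cap lie on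
different sides of its apex `a`, in flat cones at `a`, and touch the base only in its endpoints. Hence
`K` meets the polygonal lines only in vertices, `A_ε` is `K` without the vertices, and the closed
subset is `K` without the small balls, hence compact (`closedPseudoFractal_eq`).

*Approximation.* A point of `A_ε` is not a vertex, so near it `K` is a single piece of high level. If
a ball of radius `σ` around a point `z` of `K` meets `K` only inside this piece, take the deepest
piece that still contains the intersection. The ball meets both halves of it, and as the angle at
the apex `a` is obtuse, `a` has distance at most `σ` from `z`. By the cone condition the
intersection lies in a strip parallel to the base, of width a small multiple of `σ`
(`exists_line_of_subset_piece`). This is Simon's property; it passes to subsets and implies the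
weak property.

*Infinite length.* Parametrize `K` by `γ : [0, 1) → K`, mapping dyadic intervals to pieces. The
inverse of `γ` is Lipschitz on the pieces of level `N` with a constant of the order of
`(1 + 16 N ε²)^{-1/2}` (`dist_param_le`). So `volume (γ⁻¹ E) ≤ C_N * μH[1] E` for a Borel set `E`
and all `N`, where `C_N → 0`: a set whose parameters have positive measure has infinite length
(`hausdorffMeasure_eq_top`). The parameters of the removed balls have total measure at most
`8 ∑ ρ_k < 1`, so the closed subset has infinite length. As it is compact, there is a point all of
whose neighbourhoods have infinite length; there the density is infinite, and local finiteness
fails for both sets.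
-/

noncomputable section

namespace PseudoFractal

/-! ### Coordinates adapted to a segment -/

/-- The Euclidean plane. -/
abbrev Plane := EuclideanSpace ℝ (Fin 2)

/-- The point with coordinates `(α, β)` in the orthogonal frame with origin `p` whose axes are
`q - p` and its rotation by a right angle. Lengths are measured in units of `‖q - p‖`. -/
def framePoint (p q : Plane) (α β : ℝ) : Plane := p + α • (q - p) + β • rot (q - p)

theorem norm_sq_eq (v : Plane) : ‖v‖ ^ 2 = v 0 ^ 2 + v 1 ^ 2 := by
  simp [EuclideanSpace.norm_sq_eq, Fin.sum_univ_two]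

theorem dist_framePoint_sq (p q : Plane) (α β α' β' : ℝ) :
    dist (framePoint p q α β) (framePoint p q α' β') ^ 2 =
      ‖q - p‖ ^ 2 * ((α - α') ^ 2 + (β - β') ^ 2) := by
  rw [dist_eq_norm, norm_sq_eq, norm_sq_eq]
  simp [framePoint, rot]
  ring

theorem abs_sub_mul_le_dist_framePoint (p q : Plane) (α β α' β' : ℝ) :
    |α - α'| * ‖q - p‖ ≤ dist (framePoint p q α β) (framePoint p q α' β') := by
  refine abs_le_of_sq_le_sq' ?_ dist_nonneg |>.2
  rw [dist_framePoint_sq, mul_pow, sq_abs]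
  nlinarith [mul_nonneg (sq_nonneg ‖q - p‖) (sq_nonneg (β - β'))]

theorem framePoint_zero_zero (p q : Plane) : framePoint p q 0 0 = p := by simp [framePoint]

theorem framePoint_one_zero (p q : Plane) : framePoint p q 1 0 = q := by simp [framePoint]

theorem capVertex_eq_framePoint (h : ℝ) (p q : Plane) :
    capVertex h p q = framePoint p q (1 / 2) (h / ‖q - p‖) := by
  ext i
  fin_cases i <;> simp [capVertex, framePoint, midpoint_eq_smul_add] <;> ring

theorem exists_weights_of_mem_triangle {p q r x : Plane} (hx : x ∈ convexHull ℝ {p, q, r}) :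
    ∃ a b c : ℝ, 0 ≤ a ∧ 0 ≤ b ∧ 0 ≤ c ∧ a + b + c = 1 ∧ x = a • p + b • q + c • r := by
  rw [convexHull_insert (by simp), mem_convexJoin] at hx
  obtain ⟨y, hy, z, hz, hx⟩ := hx
  rw [mem_singleton_iff] at hy
  subst hy
  rw [convexHull_pair] at hz
  obtain ⟨s, t, hs, ht, hst, rfl⟩ := hz
  obtain ⟨u, v, hu, hv, huv, rfl⟩ := hx
  refine ⟨u, v * s, v * t, hu, by positivity, by positivity, ?_, ?_⟩
  · rw [add_assoc, ← mul_add, hst, mul_one, huv]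
  · rw [smul_add, smul_smul, smul_smul, add_assoc]

/-- If `l` is the length of the two equal sides of a triangle with base `L` and height `h`, then
`κ = (h / 2) / l` has the sign of `η = h / L` and is smaller in modulus: the caps over the two
sides are relatively flatter than the triangle. -/
theorem child_slope_bounds {h L l : ℝ} (hL : 0 < L) (hl : 0 ≤ l) (hll : l ^ 2 = L ^ 2 / 4 + h ^ 2)
    (h0 : h ≠ 0) :
    0 ≤ (h / 2 / l) * (h / L) ∧ (h / 2 / l) * (h / L) < (h / L) ^ 2 ∧ |h / 2 / l| ≤ |h / L| := by
  have hh : 0 < h ^ 2 := by positivity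
  have h1 : L / 2 < l := lt_of_pow_lt_pow_left₀ 2 hl (by nlinarith)
  have hl0 : 0 < l := by linarith
  refine ⟨?_, ?_, ?_⟩
  · have : (h / 2 / l) * (h / L) = h ^ 2 / (2 * l * L) := by field_simp
    rw [this]; positivity
  · have : (h / 2 / l) * (h / L) = h ^ 2 / (2 * l * L) := by field_simp
    rw [this, div_pow]
    exact div_lt_div_of_pos_left hh (by positivity) (by nlinarith)
  · rw [div_div, abs_div, abs_div, abs_of_pos hL, abs_of_pos (by positivity : 0 < 2 * l)]
    exact div_le_div_of_nonneg_left (abs_nonneg h) hL (by linarith)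

theorem sq_le_of_abs_le {h L : ℝ} (hL : 0 < L) (hh : 50 * |h| ≤ L) :
    (h / L) ^ 2 ≤ 1 / 2500 := by
  have : |h / L| ≤ 1 / 50 := by
    rw [abs_div, abs_of_pos hL, div_le_div_iff₀ hL (by norm_num)]
    linarith
  rw [← sq_abs]
  nlinarith [abs_nonneg (h / L)]

/-- The inequalities behind `left_child_frame`, for the convex combination with weights `a, b, c`
of the three vertices, whose frame coordinates are `(0, 0)`, `(1 / 2, η)` and
`(1 / 4 + κ η, (η - κ) / 2)`. -/
theorem child_weights {η κ a b c : ℝ} (ha : 0 ≤ a) (hb : 0 ≤ b) (hc : 0 ≤ c) (habc : a + b + c = 1)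
    (h1 : 0 ≤ κ * η) (h2 : κ * η < η ^ 2) (h3 : |κ| ≤ |η|) (h4 : η ^ 2 ≤ 1 / 2500) :
    0 ≤ b / 2 + c * (1 / 4 + κ * η) ∧ b / 2 + c * (1 / 4 + κ * η) ≤ 1 / 2 ∧
      |b * η + c * ((η - κ) / 2) - η| ≤ 5 * |η| * (1 / 2 - (b / 2 + c * (1 / 4 + κ * η))) ∧
      (b * η + c * ((η - κ) / 2) = 0 → b / 2 + c * (1 / 4 + κ * η) = 0) := by
  have hcκ : 0 ≤ c * (κ * η) := mul_nonneg hc h1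
  have hcκ' : c * (κ * η) ≤ c * (1 / 2500) := mul_le_mul_of_nonneg_left (by linarith) hc
  refine ⟨by positivity, by linarith, ?_, fun h => ?_⟩
  · have e : b * η + c * ((η - κ) / 2) - η = -(a * η + c * ((η + κ) / 2)) := by
      rw [← sub_eq_zero]; linear_combination η * habc
    rw [e, abs_neg]
    have e1 : |η + κ| / 2 ≤ |η| := by linarith [abs_add_le η κ]
    calc |a * η + c * ((η + κ) / 2)| ≤ |a * η| + |c * ((η + κ) / 2)| := abs_add_le _ _
      _ = a * |η| + c * (|η + κ| / 2) := by
        rw [abs_mul, abs_mul, abs_of_nonneg ha, abs_of_nonneg hc, abs_div, abs_two]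
      _ ≤ a * |η| + c * |η| := by gcongr
      _ = |η| * (a + c) := by ring
      _ ≤ |η| * (5 * (1 / 2 - (b / 2 + c * (1 / 4 + κ * η)))) := by gcongr; linarith
      _ = _ := by ring
  · have e : b * η ^ 2 + c * ((η ^ 2 - κ * η) / 2) = 0 := by linear_combination η * h
    have hη : 0 < η ^ 2 := by linarith
    have b1 : 0 ≤ b * η ^ 2 := by positivity
    have c1 : 0 ≤ c * ((η ^ 2 - κ * η) / 2) := mul_nonneg hc (by linarith)
    have b2 : b = 0 := by
      have : b * η ^ 2 = 0 := by linarith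
      exact (mul_eq_zero.1 this).resolve_right hη.ne'
    have c2 : c = 0 := by
      have : c * ((η ^ 2 - κ * η) / 2) = 0 := by linarith
      exact (mul_eq_zero.1 this).resolve_right (by linarith)
    simp [b2, c2]

/-- The frame coordinates of a point of the left of the two caps over the edges of a cap of
relative height `η` and base `[p, q]`: the point lies to the left of the apex `(1 / 2, η)`, in a
flat cone at the apex, and is not on the base unless it is `p`. -/
theorem left_child_frame {p q : Plane} {h : ℝ} (hpq : 0 < ‖q - p‖) (h0 : h ≠ 0)
    (hh : 50 * |h| ≤ ‖q - p‖) {x : Plane}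
    (hx : x ∈ convexHull ℝ {p, capVertex h p q, capVertex (-(h / 2)) p (capVertex h p q)}) :
    ∃ α β : ℝ, x = framePoint p q α β ∧ 0 ≤ α ∧ α ≤ 1 / 2 ∧
      |β - h / ‖q - p‖| ≤ 5 * |h / ‖q - p‖| * (1 / 2 - α) ∧ (β = 0 → α = 0) := by
  obtain ⟨h1, h2, h3⟩ := child_slope_bounds hpq (norm_nonneg _) (norm_capVertex_sub_left h p q hpq) h0
  have h4 := sq_le_of_abs_le hpq hh
  obtain ⟨a, b, c, ha, hb, hc, habc, rfl⟩ := exists_weights_of_mem_triangle hx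
  refine ⟨_, _, ?_, child_weights ha hb hc habc h1 h2 h3 h4⟩
  rw [capVertex_eq_framePoint (-(h / 2)), neg_div]
  generalize h / 2 / ‖capVertex h p q - p‖ = κ
  rw [capVertex_eq_framePoint]
  generalize h / ‖q - p‖ = η
  obtain rfl : a = 1 - b - c := by linarith
  ext i
  fin_cases i <;> simp [framePoint, rot] <;> ring

/-- The mirror image of `left_child_frame`. -/
theorem right_child_frame {p q : Plane} {h : ℝ} (hpq : 0 < ‖q - p‖) (h0 : h ≠ 0)
    (hh : 50 * |h| ≤ ‖q - p‖) {x : Plane}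
    (hx : x ∈ convexHull ℝ {capVertex h p q, q, capVertex (-(h / 2)) (capVertex h p q) q}) :
    ∃ α β : ℝ, x = framePoint p q α β ∧ 1 / 2 ≤ α ∧ α ≤ 1 ∧
      |β - h / ‖q - p‖| ≤ 5 * |h / ‖q - p‖| * (α - 1 / 2) ∧ (β = 0 → α = 1) := by
  obtain ⟨h1, h2, h3⟩ := child_slope_bounds hpq (norm_nonneg _)
    (norm_sub_capVertex_right h p q hpq) h0
  have h4 := sq_le_of_abs_le hpq hh
  obtain ⟨b, a, c, hb, ha, hc, habc, rfl⟩ := exists_weights_of_mem_triangle hx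
  obtain ⟨k1, k2, k3, k4⟩ := child_weights ha hb hc (by linarith) h1 h2 h3 h4
  refine ⟨1 - (b / 2 + c * (1 / 4 + h / 2 / ‖q - capVertex h p q‖ * (h / ‖q - p‖))), _, ?_,
    by linarith, by linarith, k3.trans_eq (by ring), fun h => by linarith [k4 h]⟩
  rw [capVertex_eq_framePoint (-(h / 2)), neg_div]
  generalize h / 2 / ‖q - capVertex h p q‖ = κ
  rw [capVertex_eq_framePoint]
  generalize h / ‖q - p‖ = η
  obtain rfl : a = 1 - b - c := by linarith
  ext i
  fin_cases i <;> simp [framePoint, rot] <;> ring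

/-! ### Lengths and slopes -/

/-- The common length `(1 + 16 n ε²)^{1/2} / 2^n` of the segments of level `n`. -/
def edgeLen (ε : ℝ) (n : ℕ) : ℝ := √(1 + n * (16 * ε ^ 2)) / 2 ^ n

/-- The signed ratio of height and base of the caps of level `n`. -/
def slope (ε : ℝ) (n : ℕ) : ℝ := capHeight ε n / edgeLen ε n

theorem edgeLen_pos (ε : ℝ) (n : ℕ) : 0 < edgeLen ε n := by unfold edgeLen; positivity

theorem norm_edge (ε : ℝ) (n i : ℕ) : ‖(edge ε n i).2 - (edge ε n i).1‖ = edgeLen ε n := by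
  refine (sq_eq_sq₀ (norm_nonneg _) (edgeLen_pos ε n).le).1 ?_
  rw [edge_length_sq, edgeLen, div_pow, Real.sq_sqrt (by positivity), ← pow_mul, mul_comm n 2,
    pow_mul]
  norm_num

theorem one_div_le_edgeLen (ε : ℝ) (n : ℕ) : 1 / 2 ^ n ≤ edgeLen ε n := by
  unfold edgeLen
  gcongr
  exact Real.one_le_sqrt.2 (by linarith [show (0 : ℝ) ≤ n * (16 * ε ^ 2) by positivity])

theorem abs_capHeight {ε : ℝ} (h0 : 0 < ε) (n : ℕ) : |capHeight ε n| = 2 * ε / 2 ^ n := by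
  rw [capHeight, abs_mul, abs_pow, abs_neg, abs_one, one_pow, one_mul, abs_of_pos (by positivity)]

theorem abs_slope {ε : ℝ} (h0 : 0 < ε) (n : ℕ) :
    |slope ε n| = 2 * ε / √(1 + n * (16 * ε ^ 2)) := by
  have : 0 < √(1 + n * (16 * ε ^ 2)) := by positivity
  rw [slope, abs_div, abs_capHeight h0, abs_of_pos (edgeLen_pos ε n), edgeLen]
  field_simp

theorem fifty_mul_abs_capHeight_le {ε : ℝ} (h0 : 0 < ε) (h1 : ε < 1 / 100) (n : ℕ) :
    50 * |capHeight ε n| ≤ edgeLen ε n := by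
  refine le_trans ?_ (one_div_le_edgeLen ε n)
  rw [abs_capHeight h0, ← mul_div_assoc]
  gcongr
  linarith

theorem abs_slope_le {ε : ℝ} (h0 : 0 < ε) (h1 : ε < 1 / 100) (n : ℕ) : |slope ε n| ≤ 1 / 50 := by
  rw [slope, abs_div, abs_of_pos (edgeLen_pos ε n), div_le_div_iff₀ (edgeLen_pos ε n) (by norm_num)]
  linarith [fifty_mul_abs_capHeight_le h0 h1 n]

theorem tendsto_sqrt_growth {ε : ℝ} (h0 : 0 < ε) :
    Tendsto (fun n : ℕ => √(1 + n * (16 * ε ^ 2))) atTop atTop :=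
  Real.tendsto_sqrt_atTop.comp (tendsto_atTop_add_const_left _ _
    (tendsto_natCast_atTop_atTop.atTop_mul_const (by positivity)))

theorem monotone_sqrt_growth (ε : ℝ) : Monotone (fun n : ℕ => √(1 + n * (16 * ε ^ 2))) :=
  fun m n h => Real.sqrt_le_sqrt (by gcongr)

theorem tendsto_abs_slope {ε : ℝ} (h0 : 0 < ε) : Tendsto (fun n => |slope ε n|) atTop (𝓝 0) := by
  simp_rw [abs_slope h0]
  exact (tendsto_sqrt_growth h0).const_div_atTop _

theorem antitone_abs_slope {ε : ℝ} (h0 : 0 < ε) : Antitone (fun n => |slope ε n|) := by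
  intro m n h
  simp only [abs_slope h0]
  exact div_le_div_of_nonneg_left (by positivity) (by positivity) (monotone_sqrt_growth ε h)

theorem edgeLen_le {ε : ℝ} (h0 : 0 < ε) (h1 : ε < 1 / 100) (n : ℕ) : edgeLen ε n ≤ 1 / √2 ^ n := by
  have h2 : √(1 + n * (16 * ε ^ 2)) ≤ √2 ^ n := by
    refine Real.sqrt_le_iff.2 ⟨by positivity, ?_⟩
    rw [← pow_mul, mul_comm n 2, pow_mul, Real.sq_sqrt (by norm_num)]
    refine le_trans ?_ (one_add_mul_le_pow (a := (1 : ℝ)) (by norm_num) n |>.trans_eq (by norm_num))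
    gcongr
    nlinarith
  unfold edgeLen
  rw [div_le_div_iff₀ (by positivity) (by positivity), one_mul]
  calc √(1 + n * (16 * ε ^ 2)) * √2 ^ n ≤ √2 ^ n * √2 ^ n := by gcongr
    _ = 2 ^ n := by rw [← mul_pow, Real.mul_self_sqrt (by norm_num)]

theorem tendsto_edgeLen {ε : ℝ} (h0 : 0 < ε) (h1 : ε < 1 / 100) :
    Tendsto (edgeLen ε) atTop (𝓝 0) := by
  refine squeeze_zero (fun n => (edgeLen_pos ε n).le) (edgeLen_le h0 h1) ?_
  simp_rw [← one_div_pow]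
  refine tendsto_pow_atTop_nhds_zero_of_lt_one (by positivity) ?_
  rw [div_lt_one (by positivity)]
  exact Real.lt_sqrt_of_sq_lt (by norm_num)

/-! ### The caps over the two edges of a cap -/

theorem cap_left_frame {ε : ℝ} (h0 : 0 < ε) (h1 : ε < 1 / 100) {n k : ℕ} {x : Plane}
    (hx : x ∈ cap ε (n + 1) (2 * k)) :
    ∃ α β : ℝ, x = framePoint (edge ε n k).1 (edge ε n k).2 α β ∧ 0 ≤ α ∧ α ≤ 1 / 2 ∧
      |β - slope ε n| ≤ 5 * |slope ε n| * (1 / 2 - α) ∧ (β = 0 → α = 0) := by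
  obtain ⟨hp, hn, -⟩ := edge_pos_and_height_le ε h0 h1 n k
  rw [cap, apex, edge_succ_even, capHeight_succ] at hx
  have := left_child_frame hp hn
    (by rw [norm_edge]; exact fifty_mul_abs_capHeight_le h0 h1 n) hx
  rwa [norm_edge] at this

theorem cap_right_frame {ε : ℝ} (h0 : 0 < ε) (h1 : ε < 1 / 100) {n k : ℕ} {x : Plane}
    (hx : x ∈ cap ε (n + 1) (2 * k + 1)) :
    ∃ α β : ℝ, x = framePoint (edge ε n k).1 (edge ε n k).2 α β ∧ 1 / 2 ≤ α ∧ α ≤ 1 ∧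
      |β - slope ε n| ≤ 5 * |slope ε n| * (α - 1 / 2) ∧ (β = 0 → α = 1) := by
  obtain ⟨hp, hn, -⟩ := edge_pos_and_height_le ε h0 h1 n k
  rw [cap, apex, edge_succ_odd, capHeight_succ] at hx
  have := right_child_frame hp hn
    (by rw [norm_edge]; exact fifty_mul_abs_capHeight_le h0 h1 n) hx
  rwa [norm_edge] at this

theorem apex_eq_framePoint (ε : ℝ) (n k : ℕ) :
    apex ε n k = framePoint (edge ε n k).1 (edge ε n k).2 (1 / 2) (slope ε n) := by
  rw [apex, capVertex_eq_framePoint, norm_edge, slope]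

/-- The angle at the apex between points of the two caps over the edges of a cap is not acute. -/
theorem dist_apex_sq_add_le {ε : ℝ} (h0 : 0 < ε) (h1 : ε < 1 / 100) {n k : ℕ} {x y : Plane}
    (hx : x ∈ cap ε (n + 1) (2 * k)) (hy : y ∈ cap ε (n + 1) (2 * k + 1)) :
    dist x (apex ε n k) ^ 2 + dist y (apex ε n k) ^ 2 ≤ dist x y ^ 2 := by
  obtain ⟨α, β, rfl, -, hα, hβ, -⟩ := cap_left_frame h0 h1 hx
  obtain ⟨α', β', rfl, hα', -, hβ', -⟩ := cap_right_frame h0 h1 hy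
  have hs := abs_slope_le h0 h1 n
  rw [apex_eq_framePoint, dist_framePoint_sq, dist_framePoint_sq, dist_framePoint_sq, ← mul_add]
  refine mul_le_mul_of_nonneg_left ?_ (sq_nonneg _)
  have b1 : |β - slope ε n| ≤ 1 / 2 - α := hβ.trans (by nlinarith)
  have b2 : |β' - slope ε n| ≤ α' - 1 / 2 := hβ'.trans (by nlinarith)
  have : |(β - slope ε n) * (β' - slope ε n)| ≤ (1 / 2 - α) * (α' - 1 / 2) := by
    rw [abs_mul]; gcongr
  nlinarith [le_abs_self ((β - slope ε n) * (β' - slope ε n))]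

theorem half_edgeLen_le_dist_right {ε : ℝ} (h0 : 0 < ε) (h1 : ε < 1 / 100) {n k : ℕ} {x : Plane}
    (hx : x ∈ cap ε (n + 1) (2 * k)) : edgeLen ε n / 2 ≤ dist x (edge ε n k).2 := by
  obtain ⟨α, β, rfl, -, hα, -, -⟩ := cap_left_frame h0 h1 hx
  have := abs_sub_mul_le_dist_framePoint (edge ε n k).1 (edge ε n k).2 α β 1 0
  rw [framePoint_one_zero, norm_edge] at this
  refine le_trans ?_ this
  rw [div_eq_inv_mul]
  exact mul_le_mul_of_nonneg_right (by rw [abs_of_nonpos] <;> linarith) (edgeLen_pos ε n).le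

theorem half_edgeLen_le_dist_left {ε : ℝ} (h0 : 0 < ε) (h1 : ε < 1 / 100) {n k : ℕ} {x : Plane}
    (hx : x ∈ cap ε (n + 1) (2 * k + 1)) : edgeLen ε n / 2 ≤ dist x (edge ε n k).1 := by
  obtain ⟨α, β, rfl, hα, -, -, -⟩ := cap_right_frame h0 h1 hx
  have := abs_sub_mul_le_dist_framePoint (edge ε n k).1 (edge ε n k).2 α β 0 0
  rw [framePoint_zero_zero, norm_edge] at this
  refine le_trans ?_ this
  rw [div_eq_inv_mul]
  exact mul_le_mul_of_nonneg_right (by rw [abs_of_nonneg] <;> linarith) (edgeLen_pos ε n).le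

/-- The two caps over the edges of a cap lie in a double cone at the apex that is flat in the
direction of the base, of opening controlled by `slope`. -/
theorem child_flat {ε : ℝ} (h0 : 0 < ε) (h1 : ε < 1 / 100) {n k : ℕ} {x : Plane}
    (hx : x ∈ cap ε (n + 1) (2 * k) ∪ cap ε (n + 1) (2 * k + 1)) :
    ∃ α β : ℝ, x = framePoint (edge ε n k).1 (edge ε n k).2 α β ∧
      |β - slope ε n| * edgeLen ε n ≤ 5 * |slope ε n| * dist x (apex ε n k) := by
  have key : ∃ α β : ℝ, x = framePoint (edge ε n k).1 (edge ε n k).2 α β ∧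
      |β - slope ε n| ≤ 5 * |slope ε n| * |α - 1 / 2| := by
    rcases hx with hx | hx
    · obtain ⟨α, β, h, -, hα, hβ, -⟩ := cap_left_frame h0 h1 hx
      exact ⟨α, β, h, by rwa [abs_of_nonpos (a := α - 1 / 2) (by linarith), neg_sub]⟩
    · obtain ⟨α, β, h, hα, -, hβ, -⟩ := cap_right_frame h0 h1 hx
      exact ⟨α, β, h, by rwa [abs_of_nonneg (a := α - 1 / 2) (by linarith)]⟩
  obtain ⟨α, β, rfl, hβ⟩ := key
  refine ⟨α, β, rfl, ?_⟩
  have := abs_sub_mul_le_dist_framePoint (edge ε n k).1 (edge ε n k).2 α β (1 / 2) (slope ε n)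
  rw [← apex_eq_framePoint, norm_edge] at this
  calc |β - slope ε n| * edgeLen ε n ≤ 5 * |slope ε n| * |α - 1 / 2| * edgeLen ε n :=
        mul_le_mul_of_nonneg_right hβ (edgeLen_pos ε n).le
    _ = 5 * |slope ε n| * (|α - 1 / 2| * edgeLen ε n) := by ring
    _ ≤ _ := by gcongr

theorem framePoint_snd_eq_zero_of_mem_segment {p q : Plane} (hpq : 0 < ‖q - p‖) {α β : ℝ}
    (h : framePoint p q α β ∈ segment ℝ p q) : β = 0 := by
  rw [segment_eq_image'] at h
  obtain ⟨θ, -, h⟩ := h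
  have h' : framePoint p q θ 0 = framePoint p q α β := by rw [← h]; simp [framePoint]
  have := dist_framePoint_sq p q θ 0 α β
  rw [h', dist_self] at this
  have h2 : (θ - α) ^ 2 + (0 - β) ^ 2 = 0 := by
    have h3 : ‖q - p‖ ^ 2 * ((θ - α) ^ 2 + (0 - β) ^ 2) = 0 := by rw [← this]; norm_num
    exact (mul_eq_zero.1 h3).resolve_left (by positivity)
  nlinarith [sq_nonneg (θ - α), sq_nonneg β]

/-- The caps over the edges of a cap meet its base only in the endpoints of the base. -/
theorem base_inter_children {ε : ℝ} (h0 : 0 < ε) (h1 : ε < 1 / 100) {n k : ℕ} {x : Plane}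
    (hx : x ∈ cap ε (n + 1) (2 * k) ∪ cap ε (n + 1) (2 * k + 1))
    (hs : x ∈ segment ℝ (edge ε n k).1 (edge ε n k).2) :
    x = (edge ε n k).1 ∨ x = (edge ε n k).2 := by
  have hp := (edge_pos_and_height_le ε h0 h1 n k).1
  rcases hx with hx | hx
  · obtain ⟨α, β, rfl, -, -, -, h⟩ := cap_left_frame h0 h1 hx
    have hβ := framePoint_snd_eq_zero_of_mem_segment hp hs
    left
    rw [h hβ, hβ, framePoint_zero_zero]
  · obtain ⟨α, β, rfl, -, -, -, h⟩ := cap_right_frame h0 h1 hx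
    have hβ := framePoint_snd_eq_zero_of_mem_segment hp hs
    right
    rw [h hβ, hβ, framePoint_one_zero]

theorem eq_apex_of_mem_children {ε : ℝ} (h0 : 0 < ε) (h1 : ε < 1 / 100) {n k : ℕ} {x : Plane}
    (hx : x ∈ cap ε (n + 1) (2 * k)) (hy : x ∈ cap ε (n + 1) (2 * k + 1)) : x = apex ε n k := by
  have := dist_apex_sq_add_le h0 h1 hx hy
  rw [dist_self] at this
  exact dist_eq_zero.1 (by nlinarith [sq_nonneg (dist x (apex ε n k))])

/-! ### Vertices and the caps of one level -/

/-- `x` is an endpoint of the segment `A_{n,i}`. -/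
def IsEndpoint (ε : ℝ) (n i : ℕ) (x : Plane) : Prop := x = (edge ε n i).1 ∨ x = (edge ε n i).2

theorem IsEndpoint.mem_segment {ε : ℝ} {n i : ℕ} {x : Plane} (h : IsEndpoint ε n i x) :
    x ∈ segment ℝ (edge ε n i).1 (edge ε n i).2 := by
  rcases h with rfl | rfl
  · exact left_mem_segment _ _ _
  · exact right_mem_segment _ _ _

theorem segment_subset_cap (ε : ℝ) (n i : ℕ) :
    segment ℝ (edge ε n i).1 (edge ε n i).2 ⊆ cap ε n i :=
  segment_subset_convexHull (by simp) (by simp)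

theorem IsEndpoint.mem_cap {ε : ℝ} {n i : ℕ} {x : Plane} (h : IsEndpoint ε n i x) :
    x ∈ cap ε n i := segment_subset_cap ε n i h.mem_segment

theorem apex_mem_cap (ε : ℝ) (n i : ℕ) : apex ε n i ∈ cap ε n i :=
  subset_convexHull _ _ (by simp)

theorem isClosed_cap (ε : ℝ) (n i : ℕ) : IsClosed (cap ε n i) :=
  ((finite_singleton _).insert _ |>.insert _).isClosed_convexHull ℝ

theorem IsEndpoint.exists_child {ε : ℝ} {n i : ℕ} {x : Plane} (h : IsEndpoint ε n i x) :
    ∃ j, j / 2 = i ∧ IsEndpoint ε (n + 1) j x := by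
  rcases h with rfl | rfl
  · exact ⟨2 * i, by omega, by rw [IsEndpoint, edge_succ_even]; simp⟩
  · exact ⟨2 * i + 1, by omega, by rw [IsEndpoint, edge_succ_odd]; simp⟩

theorem isEndpoint_left_apex (ε : ℝ) (n k : ℕ) : IsEndpoint ε (n + 1) (2 * k) (apex ε n k) := by
  rw [IsEndpoint, edge_succ_even]; simp

theorem isEndpoint_right_apex (ε : ℝ) (n k : ℕ) :
    IsEndpoint ε (n + 1) (2 * k + 1) (apex ε n k) := by
  rw [IsEndpoint, edge_succ_odd]; simp

/-- An endpoint of a segment lies in only one of the two caps of the next level, and is an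
endpoint of the base of this cap. -/
theorem IsEndpoint.of_mem_child {ε : ℝ} (h0 : 0 < ε) (h1 : ε < 1 / 100) {n i : ℕ} {x : Plane}
    (h : IsEndpoint ε n (i / 2) x) (hx : x ∈ cap ε (n + 1) i) : IsEndpoint ε (n + 1) i x := by
  have hl := edgeLen_pos ε n
  obtain ⟨k, rfl | rfl⟩ := Nat.even_or_odd' i
  · rw [show 2 * k / 2 = k by omega] at h
    rcases h with rfl | rfl
    · left; rw [edge_succ_even]
    · have := half_edgeLen_le_dist_right h0 h1 hx
      rw [dist_self] at this
      linarith
  · rw [show (2 * k + 1) / 2 = k by omega] at h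
    rcases h with rfl | rfl
    · have := half_edgeLen_le_dist_left h0 h1 hx
      rw [dist_self] at this
      linarith
    · right; rw [edge_succ_odd]

/-- Different caps of the same level meet only in endpoints of their bases. -/
theorem isEndpoint_of_mem_caps {ε : ℝ} (h0 : 0 < ε) (h1 : ε < 1 / 100) {n i j : ℕ} {x : Plane}
    (hi : i < 2 ^ n) (hj : j < 2 ^ n) (hij : i ≠ j) (hxi : x ∈ cap ε n i) (hxj : x ∈ cap ε n j) :
    IsEndpoint ε n i x := by
  induction n generalizing i j with
  | zero => omega
  | succ n ih =>
    have sub : ∀ i, cap ε (n + 1) i ⊆ cap ε n (i / 2) := fun i => by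
      obtain ⟨k, rfl | rfl⟩ := Nat.even_or_odd' i
      · rw [show 2 * k / 2 = k by omega]; exact cap_left_subset ε h0 h1 n k
      · rw [show (2 * k + 1) / 2 = k by omega]; exact cap_right_subset ε h0 h1 n k
    by_cases h : i / 2 = j / 2
    · obtain ⟨k, rfl | rfl⟩ := Nat.even_or_odd' i
      · obtain rfl : j = 2 * k + 1 := by omega
        rw [eq_apex_of_mem_children h0 h1 hxi hxj]
        exact isEndpoint_left_apex ε n k
      · obtain rfl : j = 2 * k := by omega
        rw [eq_apex_of_mem_children h0 h1 hxj hxi]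
        exact isEndpoint_right_apex ε n k
    · rw [pow_succ] at hi hj
      exact (ih (by omega) (by omega) h (sub i hxi) (sub j hxj)).of_mem_child h0 h1 hxi

theorem cap_subset_of_div {ε : ℝ} (h0 : 0 < ε) (h1 : ε < 1 / 100) (m j i : ℕ) :
    cap ε (m + j) i ⊆ cap ε m (i / 2 ^ j) := by
  induction j generalizing i with
  | zero => simp
  | succ j ih =>
    have : cap ε (m + j + 1) i ⊆ cap ε (m + j) (i / 2) := by
      obtain ⟨k, rfl | rfl⟩ := Nat.even_or_odd' i
      · rw [show 2 * k / 2 = k by omega]; exact cap_left_subset ε h0 h1 _ k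
      · rw [show (2 * k + 1) / 2 = k by omega]; exact cap_right_subset ε h0 h1 _ k
    refine this.trans ((ih _).trans ?_)
    rw [Nat.div_div_eq_div_mul, ← pow_succ']

/-! ### The limit curve and its pieces -/

/-- The endpoints of the segments that arise from `A_{m,k}` (at levels `≥ m`). -/
def vertices (ε : ℝ) (m k : ℕ) : Set Plane :=
  {x | ∃ j i, i / 2 ^ j = k ∧ IsEndpoint ε (m + j) i x}

/-- The part over `A_{m,k}` of the limit of the polygonal lines `A_n`, as the closure of a set of
vertices. In particular `piece ε 0 0` is the whole limit curve. -/
def piece (ε : ℝ) (m k : ℕ) : Set Plane := closure (vertices ε m k)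

theorem vertices_eq_union (ε : ℝ) (m k : ℕ) :
    vertices ε m k = vertices ε (m + 1) (2 * k) ∪ vertices ε (m + 1) (2 * k + 1) := by
  ext x
  constructor
  · have key : ∀ j i, i / 2 ^ (j + 1) = k → IsEndpoint ε (m + 1 + j) i x →
        x ∈ vertices ε (m + 1) (2 * k) ∪ vertices ε (m + 1) (2 * k + 1) := by
      intro j i hi h
      rw [pow_succ, ← Nat.div_div_eq_div_mul] at hi
      rcases (by omega : i / 2 ^ j = 2 * k ∨ i / 2 ^ j = 2 * k + 1) with hi | hi
      · exact Or.inl ⟨j, i, hi, h⟩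
      · exact Or.inr ⟨j, i, hi, h⟩
    rintro ⟨_ | j, i, hi, h⟩
    · obtain ⟨i', hi', h'⟩ := h.exists_child
      exact key 0 i' (by simpa [hi'] using hi) h'
    · exact key j i hi (by rwa [add_assoc, add_comm 1 j])
  · rintro (⟨j, i, hi, h⟩ | ⟨j, i, hi, h⟩) <;>
    · refine ⟨j + 1, i, ?_, by rwa [add_comm j 1, ← add_assoc]⟩
      rw [pow_succ, ← Nat.div_div_eq_div_mul]
      omega

theorem piece_eq_union (ε : ℝ) (m k : ℕ) :
    piece ε m k = piece ε (m + 1) (2 * k) ∪ piece ε (m + 1) (2 * k + 1) := by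
  rw [piece, vertices_eq_union, closure_union]; rfl

theorem isClosed_piece (ε : ℝ) (m k : ℕ) : IsClosed (piece ε m k) := isClosed_closure

theorem piece_subset_cap {ε : ℝ} (h0 : 0 < ε) (h1 : ε < 1 / 100) (m k : ℕ) :
    piece ε m k ⊆ cap ε m k := by
  refine closure_minimal ?_ (isClosed_cap ε m k)
  rintro x ⟨j, i, rfl, h⟩
  exact cap_subset_of_div h0 h1 m j i h.mem_cap

theorem piece_subset_children {ε : ℝ} (h0 : 0 < ε) (h1 : ε < 1 / 100) (m k : ℕ) :
    piece ε m k ⊆ cap ε (m + 1) (2 * k) ∪ cap ε (m + 1) (2 * k + 1) := by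
  rw [piece_eq_union]
  exact union_subset_union (piece_subset_cap h0 h1 _ _) (piece_subset_cap h0 h1 _ _)

theorem isCompact_piece {ε : ℝ} (h0 : 0 < ε) (h1 : ε < 1 / 100) (m k : ℕ) :
    IsCompact (piece ε m k) :=
  (((finite_singleton _).insert _ |>.insert _).isCompact_convexHull ℝ).of_isClosed_subset
    (isClosed_piece ε m k) (piece_subset_cap h0 h1 m k)

theorem exists_mem_piece {ε : ℝ} {x : Plane} (hx : x ∈ piece ε 0 0) (n : ℕ) :
    ∃ i < 2 ^ n, x ∈ piece ε n i := by
  induction n with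
  | zero => exact ⟨0, by simp, hx⟩
  | succ n ih =>
    obtain ⟨i, hi, h⟩ := ih
    rw [piece_eq_union] at h
    rw [pow_succ]
    rcases h with h | h
    · exact ⟨_, by omega, h⟩
    · exact ⟨_, by omega, h⟩

theorem dist_le_of_mem_cap {ε : ℝ} (h0 : 0 < ε) (h1 : ε < 1 / 100) {n i : ℕ} {x : Plane}
    (hx : x ∈ cap ε n i) : dist x (edge ε n i).1 ≤ edgeLen ε n := by
  suffices cap ε n i ⊆ Metric.closedBall (edge ε n i).1 (edgeLen ε n) from this hx
  have hl := edgeLen_pos ε n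
  refine convexHull_min ?_ (convex_closedBall _ _)
  rintro y (rfl | rfl | rfl)
  · exact Metric.mem_closedBall_self hl.le
  · rw [Metric.mem_closedBall, dist_eq_norm, norm_edge]
  · rw [Metric.mem_closedBall, dist_eq_norm]
    refine le_of_sq_le_sq ?_ hl.le
    rw [apex, norm_capVertex_sub_left _ _ _ (edge_pos_and_height_le ε h0 h1 n i).1, norm_edge,
      ← sq_abs (capHeight ε n)]
    have := fifty_mul_abs_capHeight_le h0 h1 n
    nlinarith [abs_nonneg (capHeight ε n)]

theorem mem_vertices_zero_iff {ε : ℝ} {x : Plane} :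
    x ∈ vertices ε 0 0 ↔ ∃ n, ∃ i < 2 ^ n, IsEndpoint ε n i x := by
  simp only [vertices, mem_ofPred_eq, zero_add]
  refine exists_congr fun n => exists_congr fun i => and_congr_left fun _ => ?_
  rw [Nat.div_eq_zero_iff]
  simp

theorem IsEndpoint.exists_add {ε : ℝ} {n i : ℕ} {x : Plane} (hi : i < 2 ^ n)
    (h : IsEndpoint ε n i x) (m : ℕ) : ∃ j < 2 ^ (n + m), IsEndpoint ε (n + m) j x := by
  induction m with
  | zero => exact ⟨i, hi, h⟩
  | succ m ih =>
    obtain ⟨j, hj, h'⟩ := ih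
    obtain ⟨j', hj', h'⟩ := h'.exists_child
    exact ⟨j', by rw [← add_assoc, pow_succ]; omega, h'⟩

theorem mem_stage {ε : ℝ} {n : ℕ} {x : Plane} :
    x ∈ stage ε n ↔ ∃ i < 2 ^ n, x ∈ segment ℝ (edge ε n i).1 (edge ε n i).2 := by
  simp [stage]

/-- The limit curve meets the polygonal line `A_n` only in vertices of level `n`. -/
theorem exists_isEndpoint_of_mem_stage {ε : ℝ} (h0 : 0 < ε) (h1 : ε < 1 / 100) {n : ℕ} {x : Plane}
    (hx : x ∈ piece ε 0 0) (hs : x ∈ stage ε n) : ∃ i < 2 ^ n, IsEndpoint ε n i x := by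
  obtain ⟨i, hi, hs⟩ := mem_stage.1 hs
  obtain ⟨j, hj, hx⟩ := exists_mem_piece hx n
  refine ⟨i, hi, ?_⟩
  rcases eq_or_ne i j with rfl | hij
  · exact base_inter_children h0 h1 (piece_subset_children h0 h1 _ _ hx) hs
  · exact isEndpoint_of_mem_caps h0 h1 hi hj hij (segment_subset_cap ε n i hs)
      (piece_subset_cap h0 h1 _ _ hx)

theorem not_isEndpoint_apex (ε : ℝ) (n i : ℕ) : ¬ IsEndpoint ε n i (apex ε n i) := by
  have hl := edgeLen_pos ε n
  have a1 := abs_sub_mul_le_dist_framePoint (edge ε n i).1 (edge ε n i).2 (1 / 2) (slope ε n) 0 0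
  have a2 := abs_sub_mul_le_dist_framePoint (edge ε n i).1 (edge ε n i).2 (1 / 2) (slope ε n) 1 0
  rw [← apex_eq_framePoint, norm_edge] at a1 a2
  rw [framePoint_zero_zero] at a1
  rw [framePoint_one_zero] at a2
  rintro (h | h)
  · rw [← h, dist_self] at a1
    norm_num at a1
    linarith
  · rw [← h, dist_self] at a2
    norm_num [abs_of_neg] at a2
    linarith

theorem apex_mem_piece (ε : ℝ) {n i : ℕ} (hi : i < 2 ^ n) : apex ε n i ∈ piece ε 0 0 :=
  subset_closure (mem_vertices_zero_iff.2 ⟨n + 1, 2 * i, by rw [pow_succ]; omega,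
    isEndpoint_left_apex ε n i⟩)

theorem apex_notMem_stage {ε : ℝ} (h0 : 0 < ε) (h1 : ε < 1 / 100) {m n i : ℕ} (hmn : m ≤ n)
    (hi : i < 2 ^ n) : apex ε n i ∉ stage ε m := by
  intro hs
  obtain ⟨k, hk, h⟩ := exists_isEndpoint_of_mem_stage h0 h1 (apex_mem_piece ε hi) hs
  obtain ⟨d, rfl⟩ := Nat.exists_eq_add_of_le hmn
  obtain ⟨j, hj, h⟩ := h.exists_add hk d
  rcases eq_or_ne i j with rfl | hij
  · exact not_isEndpoint_apex ε _ _ h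
  · exact not_isEndpoint_apex ε _ _
      (isEndpoint_of_mem_caps h0 h1 hi hj hij (apex_mem_cap ε _ _) h.mem_cap)

theorem isClosed_stage (ε : ℝ) (n : ℕ) : IsClosed (stage ε n) := by
  refine isClosed_biUnion_finset fun i _ => ?_
  rw [← convexHull_pair]
  exact ((finite_singleton _).insert _).isClosed_convexHull ℝ

theorem vertices_subset_stages (ε : ℝ) : vertices ε 0 0 ⊆ ⋃ n ∈ Ici 1, stage ε n := by
  intro x hx
  obtain ⟨n, i, hi, h⟩ := mem_vertices_zero_iff.1 hx
  obtain ⟨j, hj, h⟩ := h.exists_add hi 1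
  exact mem_biUnion (mem_Ici.2 (by omega : 1 ≤ n + 1)) (mem_stage.2 ⟨j, hj, h.mem_segment⟩)

theorem piece_inter_stages {ε : ℝ} (h0 : 0 < ε) (h1 : ε < 1 / 100) {x : Plane}
    (hx : x ∈ piece ε 0 0) (hs : x ∈ ⋃ n ∈ Ici 1, stage ε n) : x ∈ vertices ε 0 0 := by
  obtain ⟨n, -, hs⟩ := mem_iUnion₂.1 hs
  exact mem_vertices_zero_iff.2 ⟨n, exists_isEndpoint_of_mem_stage h0 h1 hx hs⟩

theorem pseudoFractal_subset_piece {ε : ℝ} (h0 : 0 < ε) (h1 : ε < 1 / 100) :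
    pseudoFractal ε ⊆ piece ε 0 0 := by
  rintro x ⟨hx, hxs⟩
  refine Metric.mem_closure_iff.2 fun r hr => ?_
  obtain ⟨N, hN⟩ := eventually_atTop.1 ((tendsto_edgeLen h0 h1).eventually_lt_const (half_pos hr))
  have hsub : ⋃ n ∈ Ici 1, stage ε n ⊆
      (⋃ n ∈ Finset.Ico 1 N, stage ε n) ∪ ⋃ n ∈ Ici N, stage ε n := by
    refine iUnion₂_subset fun n hn y hy => ?_
    rcases lt_or_ge n N with h | h
    · exact Or.inl (mem_biUnion (Finset.mem_coe.2 (Finset.mem_Ico.2 ⟨hn, h⟩)) hy)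
    · exact Or.inr (mem_biUnion (mem_Ici.2 h) hy)
  have hx' := closure_mono hsub hx
  rw [closure_union, (isClosed_biUnion_finset fun n _ => isClosed_stage ε n).closure_eq] at hx'
  rcases hx' with hx' | hx'
  · obtain ⟨n, hn, hy⟩ := mem_iUnion₂.1 hx'
    exact absurd (mem_biUnion (mem_Ici.2 (Finset.mem_Ico.1 hn).1) hy) hxs
  · obtain ⟨w, hw, hxw⟩ := Metric.mem_closure_iff.1 hx' _ (half_pos hr)
    obtain ⟨n, hn, hw⟩ := mem_iUnion₂.1 hw
    obtain ⟨i, hi, hw⟩ := mem_stage.1 hw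
    refine ⟨(edge ε n i).1, mem_vertices_zero_iff.2 ⟨n, i, hi, Or.inl rfl⟩, ?_⟩
    have := dist_le_of_mem_cap h0 h1 (segment_subset_cap ε n i hw)
    linarith [dist_triangle x w (edge ε n i).1, hN n hn]

theorem piece_subset_closure (ε : ℝ) : piece ε 0 0 ⊆ closure (⋃ n ∈ Ici 1, stage ε n) :=
  closure_mono (vertices_subset_stages ε)

/-! ### The closed subset is compact -/

theorem rho_pos (ε : ℝ) (k : ℕ) : 0 < rho ε k := by unfold rho; positivity

theorem edgePoint_eq_apex (ε : ℝ) {k : ℕ} (hk : 3 ≤ k) :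
    ∃ i < 2 ^ Nat.log 2 (k - 2), edgePoint ε k = apex ε (Nat.log 2 (k - 2)) i := by
  refine ⟨k - 2 - 2 ^ Nat.log 2 (k - 2), ?_, ?_⟩
  · have := Nat.lt_pow_succ_log_self (b := 2) (by norm_num) (k - 2)
    rw [Nat.succ_eq_add_one, pow_succ] at this
    have := Nat.pow_log_le_self 2 (x := k - 2) (by omega)
    omega
  · rw [edgePoint, if_neg (by omega), if_neg (by omega)]

theorem radius_pos {ε : ℝ} (h0 : 0 < ε) (h1 : ε < 1 / 100) (k : ℕ) : 0 < radius ε k := by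
  unfold radius
  split_ifs with h
  · exact rho_pos ε k
  push Not at h
  refine lt_min (rho_pos ε k) (half_pos ?_)
  have hfin : {m : ℕ | m + 1 = block k ∨ m + 2 = block k}.Finite :=
    (finite_Iio (block k)).subset fun m hm => by
      rcases hm with hm | hm <;> simp only [mem_Iio] <;> omega
  have hcl : IsClosed (prevStages ε (block k)) := hfin.isClosed_biUnion fun m _ => isClosed_stage ε m
  have hne : (prevStages ε (block k)).Nonempty :=
    ⟨(edge ε (block k - 1) 0).1, mem_biUnion (Or.inl (by omega) : block k - 1 + 1 = _ ∨ _)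
      (mem_stage.2 ⟨0, by positivity, left_mem_segment _ _ _⟩)⟩
  refine (hcl.notMem_iff_infDist_pos hne).1 fun hmem => ?_
  obtain ⟨m, hm, hs⟩ := mem_iUnion₂.1 hmem
  obtain ⟨i, hi, he⟩ := edgePoint_eq_apex ε (k := k) (by omega)
  rw [he] at hs
  refine apex_notMem_stage h0 h1 ?_ hi hs
  -- blocks and levels are shifted against each other: the last vertex of level `n` is the first
  -- point of block `n`, and the other points of this block have level `n + 1`
  have hb : block k ≤ Nat.log 2 (k - 2) := by
    have h2 : Nat.log 2 (k - 1) ≤ Nat.log 2 ((k - 2) * 2) := Nat.log_mono_right (by omega)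
    rw [Nat.log_mul_base (by norm_num) (by omega)] at h2
    unfold block
    omega
  rcases hm with hm | hm <;> omega

theorem exists_edgePoint_eq {ε : ℝ} {x : Plane} (hx : x ∈ vertices ε 0 0) :
    ∃ k ∈ Ici 1, x = edgePoint ε k := by
  obtain ⟨n, i, hi, h⟩ := mem_vertices_zero_iff.1 hx
  induction n generalizing i with
  | zero =>
    rcases h with h | h
    · exact ⟨1, by simp, by simpa [edge, edgePoint] using h⟩
    · exact ⟨2, by simp, by simpa [edge, edgePoint] using h⟩
  | succ n ih =>
    have hap : ∀ k < 2 ^ n, ∃ k' ∈ Ici 1, apex ε n k = edgePoint ε k' := fun k hk =>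
      ⟨2 + (2 ^ n + k), by simp only [mem_Ici]; omega, (edgePoint_apex ε n k hk).symm⟩
    rw [pow_succ] at hi
    obtain ⟨k, rfl | rfl⟩ := Nat.even_or_odd' i
    · rw [IsEndpoint, edge_succ_even] at h
      rcases h with h | rfl
      · exact ih k (by omega) (Or.inl h)
      · exact hap k (by omega)
    · rw [IsEndpoint, edge_succ_odd] at h
      rcases h with rfl | h
      · exact hap k (by omega)
      · exact ih k (by omega) (Or.inr h)

theorem closedPseudoFractal_eq {ε : ℝ} (h0 : 0 < ε) (h1 : ε < 1 / 100) :
    closedPseudoFractal ε =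
      piece ε 0 0 \ ⋃ k ∈ Ici 1, Metric.ball (edgePoint ε k) (radius ε k) := by
  refine Subset.antisymm (sdiff_subset_sdiff_left (pseudoFractal_subset_piece h0 h1)) ?_
  rintro x ⟨hx, hb⟩
  refine ⟨⟨piece_subset_closure ε hx, fun hs => hb ?_⟩, hb⟩
  obtain ⟨k, hk, rfl⟩ := exists_edgePoint_eq (piece_inter_stages h0 h1 hx hs)
  exact mem_biUnion hk (Metric.mem_ball_self (radius_pos h0 h1 k))

theorem isCompact_closedPseudoFractal {ε : ℝ} (h0 : 0 < ε) (h1 : ε < 1 / 100) :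
    IsCompact (closedPseudoFractal ε) := by
  rw [closedPseudoFractal_eq h0 h1]
  exact (isCompact_piece h0 h1 0 0).diff (isOpen_biUnion fun _ _ => Metric.isOpen_ball)

/-! ### The approximation properties -/

/-- The line through `z` in direction `v`. -/
theorem isAffineOfDim_one_mk' {z v : Plane} (hv : v ≠ 0) :
    IsAffineOfDim 1 (AffineSubspace.mk' z (Submodule.span ℝ {v})) := by
  refine ⟨⟨z, AffineSubspace.self_mem_mk' _ _⟩, ?_⟩
  rw [AffineSubspace.direction_mk']
  exact finrank_span_singleton hv

/-- If a subset of `piece ε m k` is contained in a ball around one of its points, and in neither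
half of the piece, then the apex of the cap is close to the subset, and the subset is close
to a line parallel to the base. -/
theorem exists_line_of_meets_both {ε : ℝ} (h0 : 0 < ε) (h1 : ε < 1 / 100) {m k : ℕ} {W : Set Plane}
    {z : Plane} {σ δ : ℝ} (hσ : 0 < σ) (hz : z ∈ W) (hW : W ⊆ piece ε m k)
    (hball : W ⊆ Metric.ball z σ) (hl : ¬ W ⊆ piece ε (m + 1) (2 * k))
    (hr : ¬ W ⊆ piece ε (m + 1) (2 * k + 1)) (hδ : 15 * |slope ε m| < δ) :
    ∃ L : AffineSubspace ℝ Plane, IsAffineOfDim 1 L ∧ z ∈ L ∧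
      W ⊆ Metric.thickening (δ * σ) (L : Set Plane) := by
  have hz' := piece_subset_children h0 h1 m k (hW hz)
  have hza : dist z (apex ε m k) ≤ σ := by
    obtain ⟨w, hw, hwl⟩ := not_subset.1 hl
    obtain ⟨w', hw', hwr⟩ := not_subset.1 hr
    rw [piece_eq_union] at hW
    have hw2 := piece_subset_cap h0 h1 _ _ ((hW hw).resolve_left hwl)
    have hw2' := piece_subset_cap h0 h1 _ _ ((hW hw').resolve_right hwr)
    refine le_of_sq_le_sq ?_ hσ.le
    have hsq : ∀ u ∈ W, dist u z ^ 2 ≤ σ ^ 2 := fun u hu =>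
      pow_le_pow_left₀ dist_nonneg (Metric.mem_ball.1 (hball hu)).le 2
    rcases hz' with hz' | hz'
    · have := dist_apex_sq_add_le h0 h1 hz' hw2
      rw [dist_comm z w] at this
      linarith [hsq w hw, sq_nonneg (dist w (apex ε m k))]
    · have := dist_apex_sq_add_le h0 h1 hw2' hz'
      linarith [hsq w' hw', sq_nonneg (dist w' (apex ε m k))]
  have hp := (edge_pos_and_height_le ε h0 h1 m k).1
  refine ⟨AffineSubspace.mk' z (Submodule.span ℝ {(edge ε m k).2 - (edge ε m k).1}),
    isAffineOfDim_one_mk' (norm_pos_iff.1 hp), AffineSubspace.self_mem_mk' _ _, fun x hx => ?_⟩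
  obtain ⟨α, β, hxe, hβ⟩ := child_flat h0 h1 (piece_subset_children h0 h1 m k (hW hx))
  obtain ⟨α', β', hze, hβ'⟩ := child_flat h0 h1 hz'
  have hxa : dist x (apex ε m k) ≤ 2 * σ := by
    have := Metric.mem_ball.1 (hball hx)
    linarith [dist_triangle x z (apex ε m k)]
  refine Metric.mem_thickening_iff.2
    ⟨framePoint (edge ε m k).1 (edge ε m k).2 α β', ?_, ?_⟩
  · rw [SetLike.mem_coe, AffineSubspace.mem_mk', hze]
    refine Submodule.mem_span_singleton.2 ⟨α - α', ?_⟩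
    simp only [framePoint, vsub_eq_sub, sub_smul]
    abel
  · have hd : dist x (framePoint (edge ε m k).1 (edge ε m k).2 α β') = |β - β'| * edgeLen ε m := by
      refine (sq_eq_sq₀ dist_nonneg (mul_nonneg (abs_nonneg _) (edgeLen_pos ε m).le)).1 ?_
      rw [hxe, dist_framePoint_sq, norm_edge, mul_pow, sq_abs]
      ring
    rw [hd]
    have hs := abs_nonneg (slope ε m)
    calc |β - β'| * edgeLen ε m
        ≤ (|β - slope ε m| + |β' - slope ε m|) * edgeLen ε m := by
          refine mul_le_mul_of_nonneg_right ?_ (edgeLen_pos ε m).le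
          rw [abs_sub_comm β']
          exact abs_sub_le _ _ _
      _ ≤ 5 * |slope ε m| * (2 * σ) + 5 * |slope ε m| * σ := by
          rw [add_mul]
          refine add_le_add (hβ.trans ?_) (hβ'.trans ?_) <;> gcongr
      _ = 15 * |slope ε m| * σ := by ring
      _ < δ * σ := by gcongr

/-- Inside a piece of a sufficiently high level, the limit curve is flat at all places and
scales. -/
theorem exists_line_of_subset_piece {ε : ℝ} (h0 : 0 < ε) (h1 : ε < 1 / 100) {N k : ℕ}
    {W : Set Plane} {z : Plane} {σ δ : ℝ} (hσ : 0 < σ) (hz : z ∈ W) (hW : W ⊆ piece ε N k)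
    (hball : W ⊆ Metric.ball z σ) (hδ : 15 * |slope ε N| < δ) :
    ∃ L : AffineSubspace ℝ Plane, IsAffineOfDim 1 L ∧ z ∈ L ∧
      W ⊆ Metric.thickening (δ * σ) (L : Set Plane) := by
  by_contra hcon
  -- otherwise `W` is contained in pieces of all levels, hence is a single point
  have key : ∀ j, ∃ i, W ⊆ piece ε (N + j) i := by
    intro j
    induction j with
    | zero => exact ⟨k, hW⟩
    | succ j ih =>
      obtain ⟨i, hi⟩ := ih
      by_cases hl : W ⊆ piece ε (N + j + 1) (2 * i)
      · exact ⟨_, hl⟩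
      by_cases hr : W ⊆ piece ε (N + j + 1) (2 * i + 1)
      · exact ⟨_, hr⟩
      have := antitone_abs_slope h0 (Nat.le_add_right N j)
      exact absurd (exists_line_of_meets_both h0 h1 hσ hz hi hball hl hr
        (lt_of_le_of_lt (by gcongr) hδ)) hcon
  have hsub : ∀ x ∈ W, x = z := by
    intro x hx
    refine dist_le_zero.1 ?_
    have ht := ((tendsto_edgeLen h0 h1).comp (tendsto_add_atTop_nat N)).const_mul 2
    rw [mul_zero] at ht
    refine ge_of_tendsto' ht fun j => ?_
    obtain ⟨i, hi⟩ := key j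
    have a1 := dist_le_of_mem_cap h0 h1 (piece_subset_cap h0 h1 _ _ (hi hx))
    have a2 := dist_le_of_mem_cap h0 h1 (piece_subset_cap h0 h1 _ _ (hi hz))
    simp only [Function.comp, add_comm j N]
    linarith [dist_triangle_right x z (edge ε (N + j) i).1]
  have hp := (edge_pos_and_height_le ε h0 h1 0 0).1
  have hδ0 : 0 < δ := lt_of_le_of_lt (by positivity) hδ
  refine hcon ⟨AffineSubspace.mk' z (Submodule.span ℝ {(edge ε 0 0).2 - (edge ε 0 0).1}),
    isAffineOfDim_one_mk' (norm_pos_iff.1 hp), AffineSubspace.self_mem_mk' _ _, fun x hx => ?_⟩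
  rw [hsub x hx]
  exact Metric.self_subset_thickening (by positivity) _ (AffineSubspace.self_mem_mk' _ _)

/-- Near a point that is not a vertex, the limit curve is a single piece of arbitrarily high
level. -/
theorem exists_ball_inter_subset_piece {ε : ℝ} (h0 : 0 < ε) (h1 : ε < 1 / 100) {y : Plane}
    (hy : y ∉ vertices ε 0 0) (N : ℕ) :
    ∃ k < 2 ^ N, ∃ r > 0, piece ε 0 0 ∩ Metric.ball y r ⊆ piece ε N k := by
  induction N with
  | zero => exact ⟨0, by simp, 1, one_pos, inter_subset_left⟩
  | succ N ih =>
    obtain ⟨k, hk, r, hr, h⟩ := ih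
    have key : ∀ C : Set Plane, IsClosed C → y ∉ C → ∃ r' > 0, r' ≤ r ∧
        ∀ x ∈ Metric.ball y r', x ∉ C := by
      intro C hC hyC
      obtain ⟨r', hr', hb⟩ := Metric.isOpen_iff.1 hC.isOpen_compl y hyC
      exact ⟨min r r', lt_min hr hr', min_le_left _ _, fun x hx =>
        hb (Metric.ball_subset_ball (min_le_right _ _) hx)⟩
    rw [piece_eq_union ε N k] at h
    rw [pow_succ]
    by_cases hl : y ∈ piece ε (N + 1) (2 * k)
    · have hr' : y ∉ piece ε (N + 1) (2 * k + 1) := fun hr' => hy <| by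
        rw [eq_apex_of_mem_children h0 h1 (piece_subset_cap h0 h1 _ _ hl)
          (piece_subset_cap h0 h1 _ _ hr')]
        exact mem_vertices_zero_iff.2 ⟨N + 1, 2 * k, by rw [pow_succ]; omega,
          isEndpoint_left_apex ε N k⟩
      obtain ⟨r', hr0, hrr, hC⟩ := key _ (isClosed_piece ε _ _) hr'
      exact ⟨2 * k, by omega, r', hr0, fun x hx =>
        (h ⟨hx.1, Metric.ball_subset_ball hrr hx.2⟩).resolve_right (hC x hx.2)⟩
    · obtain ⟨r', hr0, hrr, hC⟩ := key _ (isClosed_piece ε _ _) hl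
      exact ⟨2 * k + 1, by omega, r', hr0, fun x hx =>
        (h ⟨hx.1, Metric.ball_subset_ball hrr hx.2⟩).resolve_left (hC x hx.2)⟩

theorem simonApprox_pseudoFractal {ε : ℝ} (h0 : 0 < ε) (h1 : ε < 1 / 100) :
    SimonApprox 1 (pseudoFractal ε) := by
  intro δ hδ y hy
  obtain ⟨N, hN⟩ := ((tendsto_abs_slope h0).const_mul 15 |>.eventually_lt_const
    (by simpa using hδ)).exists
  obtain ⟨k, -, r, hr, hsub⟩ := exists_ball_inter_subset_piece h0 h1
    (fun h => hy.2 (vertices_subset_stages ε h)) N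
  refine ⟨r / 3, by positivity, fun σ hσ hσp z hz => ?_⟩
  refine exists_line_of_subset_piece (W := pseudoFractal ε ∩ Metric.ball z σ) h0 h1 hσ
    ⟨hz.1, Metric.mem_ball_self hσ⟩ (fun x hx => hsub ⟨pseudoFractal_subset_piece h0 h1 hx.1, ?_⟩)
    inter_subset_right hN
  have a1 := Metric.mem_ball.1 hx.2
  have a2 := Metric.mem_closedBall.1 hz.2
  rw [Metric.mem_ball]
  linarith [dist_triangle x z y]

theorem SimonApprox.mono {n j : ℕ} {A B : Set (EuclideanSpace ℝ (Fin n))} (hA : SimonApprox j A)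
    (hBA : B ⊆ A) : SimonApprox j B := by
  intro δ hδ y hy
  obtain ⟨p, hp, h⟩ := hA δ hδ y (hBA hy)
  refine ⟨p, hp, fun σ hσ hσp z hz => ?_⟩
  obtain ⟨L, hL, hzL, hsub⟩ := h σ hσ hσp z ⟨hBA hz.1, hz.2⟩
  exact ⟨L, hL, hzL, (inter_subset_inter_left _ hBA).trans hsub⟩

/-- Simon's property implies the weak one: a ball that meets `A` is contained in a ball of
twice the radius around a point of `A`. -/
theorem SimonApprox.fineWeakApproxLocUnif {A : Set Plane} (hA : SimonApprox 1 A) :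
    FineWeakApproxLocUnif 1 A := by
  intro δ hδ y hy
  obtain ⟨p, hp, h⟩ := hA (δ / 2) (half_pos hδ) y hy
  refine ⟨p / 2, half_pos hp, fun ρ hρ hρp x hx => ?_⟩
  rcases (Metric.ball x ρ ∩ A).eq_empty_or_nonempty with he | ⟨z, hz, hzA⟩
  · obtain ⟨L, hL, -, -⟩ := h p hp le_rfl y ⟨hy, Metric.mem_closedBall_self hp.le⟩
    exact ⟨L, hL, by simp [he]⟩
  · have a1 := Metric.mem_ball.1 hz
    have a2 := Metric.mem_ball.1 hx
    obtain ⟨L, hL, -, hsub⟩ := h (2 * ρ) (by positivity) (by linarith) z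
      ⟨hzA, Metric.mem_closedBall.2 (by linarith [dist_triangle z x y])⟩
    refine ⟨L, hL, fun w hw => ?_⟩
    have := hsub ⟨hw.2, Metric.mem_ball.2
      (by linarith [Metric.mem_ball.1 hw.1, dist_triangle_right w z x])⟩
    rwa [show δ / 2 * (2 * ρ) = δ * ρ by ring] at this

/-! ### Parametrization by the unit interval -/

/-- The index of the dyadic interval of level `n` that contains `t`. -/
def dyadicIndex (t : ℝ) (n : ℕ) : ℕ := ⌊t * 2 ^ n⌋₊

theorem dyadicIndex_succ_div (t : ℝ) (n : ℕ) : dyadicIndex t (n + 1) / 2 = dyadicIndex t n := by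
  unfold dyadicIndex
  have h := Nat.floor_div_natCast (t * 2 ^ (n + 1)) 2
  rw [← h]
  congr 1
  rw [pow_succ]
  push_cast
  ring

theorem dyadicIndex_add_div (t : ℝ) (n j : ℕ) :
    dyadicIndex t (n + j) / 2 ^ j = dyadicIndex t n := by
  induction j with
  | zero => simp
  | succ j ih => rw [pow_succ', ← Nat.div_div_eq_div_mul, ← add_assoc, dyadicIndex_succ_div, ih]

theorem dyadicIndex_lt {t : ℝ} (ht : t ∈ Ico (0 : ℝ) 1) (n : ℕ) : dyadicIndex t n < 2 ^ n := by
  refine (Nat.floor_lt (mul_nonneg ht.1 (by positivity))).2 ?_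
  push_cast
  exact mul_lt_of_lt_one_left (by positivity) ht.2

theorem dyadicIndex_div_le {t : ℝ} (ht : 0 ≤ t) (n : ℕ) : (dyadicIndex t n : ℝ) / 2 ^ n ≤ t := by
  rw [div_le_iff₀ (by positivity)]
  exact Nat.floor_le (mul_nonneg ht (by positivity))

theorem lt_dyadicIndex_add_one_div (t : ℝ) (n : ℕ) :
    t < ((dyadicIndex t n : ℝ) + 1) / 2 ^ n := by
  rw [lt_div_iff₀ (by positivity)]
  exact Nat.lt_floor_add_one _

theorem dyadicIndex_mono (n : ℕ) : Monotone fun t => dyadicIndex t n := fun _ _ h =>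
  Nat.floor_mono (mul_le_mul_of_nonneg_right h (by positivity))

/-- There is a parametrization of the limit curve that maps dyadic intervals to pieces. -/
theorem exists_parametrization {ε : ℝ} (h0 : 0 < ε) (h1 : ε < 1 / 100) :
    ∃ γ : ℝ → Plane, ∀ t n, γ t ∈ piece ε n (dyadicIndex t n) := by
  have : ∀ t, (⋂ n, piece ε n (dyadicIndex t n)).Nonempty := fun t => by
    refine IsCompact.nonempty_iInter_of_sequence_nonempty_isCompact_isClosed _ (fun n => ?_)
      (fun n => ⟨(edge ε n (dyadicIndex t n)).1, subset_closure ⟨0, _, by simp, Or.inl rfl⟩⟩)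
      (isCompact_piece h0 h1 _ _) (fun n => isClosed_piece ε _ _)
    rw [piece_eq_union ε n, ← dyadicIndex_succ_div t n]
    rcases Nat.mod_two_eq_zero_or_one (dyadicIndex t (n + 1)) with h | h
    · rw [show 2 * (dyadicIndex t (n + 1) / 2) = dyadicIndex t (n + 1) by omega]
      exact subset_union_left
    · rw [show 2 * (dyadicIndex t (n + 1) / 2) + 1 = dyadicIndex t (n + 1) by omega]
      exact subset_union_right
  choose γ hγ using this
  exact ⟨γ, fun t n => mem_iInter.1 (hγ t) n⟩

/-- The constant in the comparison of parameters and distances at levels `≥ m`: twice the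
reciprocal of the length of the polygonal line `A_m`. -/
def compConst (ε : ℝ) (m : ℕ) : ℝ := 2 / √(1 + m * (16 * ε ^ 2))

theorem compConst_pos (ε : ℝ) (m : ℕ) : 0 < compConst ε m := by unfold compConst; positivity

theorem compConst_succ_le (ε : ℝ) (m : ℕ) : compConst ε (m + 1) ≤ compConst ε m :=
  div_le_div_of_nonneg_left (by norm_num) (by positivity) (monotone_sqrt_growth ε m.le_succ)

theorem tendsto_compConst {ε : ℝ} (h0 : 0 < ε) : Tendsto (compConst ε) atTop (𝓝 0) :=
  (tendsto_sqrt_growth h0).const_div_atTop 2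

theorem compConst_mul_half_edgeLen (ε : ℝ) (m : ℕ) :
    compConst ε m * (edgeLen ε m / 2) = 1 / 2 ^ m := by
  have : 0 < √(1 + m * (16 * ε ^ 2)) := by positivity
  unfold compConst edgeLen
  field_simp

/-- The distance of a point of a cap from the left endpoint of a segment of a lower level bounds
the difference of the parameters. -/
theorem param_sub_left_le {ε : ℝ} (h0 : 0 < ε) (h1 : ε < 1 / 100) {x : Plane} (j : ℕ) {m k i : ℕ}
    (hi : i / 2 ^ j = k) (hx : x ∈ cap ε (m + j) i) :
    (i : ℝ) / 2 ^ (m + j) - k / 2 ^ m ≤ compConst ε m * dist x (edge ε m k).1 := by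
  induction j generalizing m k with
  | zero =>
    obtain rfl : i = k := by simpa using hi
    rw [add_zero, sub_self]
    exact mul_nonneg (compConst_pos ε m).le dist_nonneg
  | succ j ih =>
    have hi' := hi
    rw [pow_succ, ← Nat.div_div_eq_div_mul] at hi
    have e : m + (j + 1) = m + 1 + j := by omega
    rcases (by omega : i / 2 ^ j = 2 * k ∨ i / 2 ^ j = 2 * k + 1) with hi | hi
    · have := ih (m := m + 1) hi (by rwa [← e])
      rw [edge_succ_even, ← e] at this
      have e2 : ((2 * k : ℕ) : ℝ) / 2 ^ (m + 1) = k / 2 ^ m := by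
        push_cast; rw [pow_succ]; field_simp
      rw [e2] at this
      exact this.trans (mul_le_mul_of_nonneg_right (compConst_succ_le ε m) dist_nonneg)
    · have hx' : x ∈ cap ε (m + 1) (2 * k + 1) := by
        rw [← hi]; exact cap_subset_of_div h0 h1 _ _ _ (by rwa [← e])
      have := mul_le_mul_of_nonneg_left (half_edgeLen_le_dist_left h0 h1 hx') (compConst_pos ε m).le
      rw [compConst_mul_half_edgeLen] at this
      refine le_trans ?_ this
      have hlt : i < (k + 1) * 2 ^ (j + 1) := by
        rw [← Nat.div_lt_iff_lt_mul (by positivity)]; omega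
      have hlt' : (i : ℝ) ≤ (k + 1) * 2 ^ (j + 1) := by exact_mod_cast hlt.le
      rw [sub_le_iff_le_add, ← add_div, div_le_div_iff₀ (by positivity) (by positivity), pow_add]
      calc (i : ℝ) * 2 ^ m ≤ (k + 1) * 2 ^ (j + 1) * 2 ^ m := by gcongr
        _ = _ := by ring

theorem right_sub_param_le {ε : ℝ} (h0 : 0 < ε) (h1 : ε < 1 / 100) {x : Plane} (j : ℕ) {m k i : ℕ}
    (hi : i / 2 ^ j = k) (hx : x ∈ cap ε (m + j) i) :
    ((k : ℝ) + 1) / 2 ^ m - ((i : ℝ) + 1) / 2 ^ (m + j) ≤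
      compConst ε m * dist x (edge ε m k).2 := by
  induction j generalizing m k with
  | zero =>
    obtain rfl : i = k := by simpa using hi
    rw [add_zero, sub_self]
    exact mul_nonneg (compConst_pos ε m).le dist_nonneg
  | succ j ih =>
    have hi' := hi
    rw [pow_succ, ← Nat.div_div_eq_div_mul] at hi
    have e : m + (j + 1) = m + 1 + j := by omega
    rcases (by omega : i / 2 ^ j = 2 * k + 1 ∨ i / 2 ^ j = 2 * k) with hi | hi
    · have := ih (m := m + 1) hi (by rwa [← e])
      rw [edge_succ_odd, ← e] at this
      have e2 : (((2 * k + 1 : ℕ) : ℝ) + 1) / 2 ^ (m + 1) = (k + 1) / 2 ^ m := by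
        push_cast; rw [pow_succ]; field_simp; ring
      rw [e2] at this
      exact this.trans (mul_le_mul_of_nonneg_right (compConst_succ_le ε m) dist_nonneg)
    · have hx' : x ∈ cap ε (m + 1) (2 * k) := by
        rw [← hi]; exact cap_subset_of_div h0 h1 _ _ _ (by rwa [← e])
      have := mul_le_mul_of_nonneg_left (half_edgeLen_le_dist_right h0 h1 hx')
        (compConst_pos ε m).le
      rw [compConst_mul_half_edgeLen] at this
      refine le_trans ?_ this
      have hge : k * 2 ^ (j + 1) ≤ i := by
        rw [← Nat.le_div_iff_mul_le (by positivity)]; omega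
      have hge' : (k : ℝ) * 2 ^ (j + 1) ≤ i + 1 := by
        have : (k : ℝ) * 2 ^ (j + 1) ≤ i := by exact_mod_cast hge
        linarith
      rw [sub_le_comm, ← sub_div, add_sub_cancel_right,
        div_le_div_iff₀ (by positivity) (by positivity), pow_add]
      calc (k : ℝ) * (2 ^ m * 2 ^ (j + 1)) = k * 2 ^ (j + 1) * 2 ^ m := by ring
        _ ≤ _ := by gcongr

/-- Points of two caps over the same segment `A_{m,k}` are at least as far apart as the
corresponding parameter intervals, up to the factor `2 * compConst ε m`. -/
theorem param_sub_param_le {ε : ℝ} (h0 : 0 < ε) (h1 : ε < 1 / 100) {x y : Plane} (j : ℕ)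
    {m k i i' : ℕ} (hi : i / 2 ^ j = k) (hi' : i' / 2 ^ j = k) (hii : i ≤ i')
    (hx : x ∈ cap ε (m + j) i) (hy : y ∈ cap ε (m + j) i') :
    (i' : ℝ) / 2 ^ (m + j) - ((i : ℝ) + 1) / 2 ^ (m + j) ≤ 2 * compConst ε m * dist x y := by
  induction j generalizing m k with
  | zero =>
    obtain rfl : i = i' := by simpa using hi.trans hi'.symm
    have h2 : 0 ≤ 2 * compConst ε m * dist x y := by
      have := compConst_pos ε m
      positivity
    refine le_trans ?_ h2
    rw [← sub_div]
    exact div_nonpos_of_nonpos_of_nonneg (by linarith) (by positivity)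
  | succ j ih =>
    rw [pow_succ, ← Nat.div_div_eq_div_mul] at hi hi'
    have hmono : i / 2 ^ j ≤ i' / 2 ^ j := Nat.div_le_div_right hii
    have e : m + (j + 1) = m + 1 + j := by omega
    have hc := compConst_succ_le ε m
    rw [e] at hx hy ⊢
    rcases (by omega : i / 2 ^ j = i' / 2 ^ j ∨ i / 2 ^ j = 2 * k ∧ i' / 2 ^ j = 2 * k + 1)
      with heq | ⟨hl, hr⟩
    · exact (ih heq rfl hx hy).trans (by gcongr)
    · have a1 := right_sub_param_le h0 h1 j hl hx
      have a2 := param_sub_left_le h0 h1 j hr hy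
      rw [edge_succ_even] at a1
      rw [edge_succ_odd] at a2
      push_cast at a1 a2
      have hx' : x ∈ cap ε (m + 1) (2 * k) := hl ▸ cap_subset_of_div h0 h1 _ _ _ hx
      have hy' : y ∈ cap ε (m + 1) (2 * k + 1) := hr ▸ cap_subset_of_div h0 h1 _ _ _ hy
      have hsq := dist_apex_sq_add_le h0 h1 hx' hy'
      have d1 : dist x (apex ε m k) ≤ dist x y :=
        le_of_sq_le_sq (by linarith [sq_nonneg (dist y (apex ε m k))]) dist_nonneg
      have d2 : dist y (apex ε m k) ≤ dist x y :=
        le_of_sq_le_sq (by linarith [sq_nonneg (dist x (apex ε m k))]) dist_nonneg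
      have b1 : compConst ε (m + 1) * dist x (apex ε m k) ≤ compConst ε m * dist x y :=
        mul_le_mul hc d1 dist_nonneg (compConst_pos ε m).le
      have b2 : compConst ε (m + 1) * dist y (apex ε m k) ≤ compConst ε m * dist x y :=
        mul_le_mul hc d2 dist_nonneg (compConst_pos ε m).le
      linarith

/-- The inverse of a parametrization is Lipschitz on every piece of level `N`, with a constant that
tends to `0` as `N → ∞`. -/
theorem dist_param_le {ε : ℝ} (h0 : 0 < ε) (h1 : ε < 1 / 100) {γ : ℝ → Plane}
    (hγ : ∀ t n, γ t ∈ piece ε n (dyadicIndex t n)) {N : ℕ} {s t : ℝ} (hs : 0 ≤ s) (ht : 0 ≤ t)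
    (hst : dyadicIndex s N = dyadicIndex t N) :
    dist s t ≤ 2 * compConst ε N * dist (γ s) (γ t) := by
  wlog hle : s ≤ t generalizing s t
  · rw [dist_comm s, dist_comm (γ s)]
    exact this ht hs hst.symm (le_of_not_ge hle)
  rw [dist_comm, Real.dist_eq, abs_of_nonneg (by linarith)]
  have hlim : Tendsto (fun j : ℕ => 2 * compConst ε N * dist (γ s) (γ t) + 2 * (1 / 2 : ℝ) ^ (N + j))
      atTop (𝓝 (2 * compConst ε N * dist (γ s) (γ t) + 2 * 0)) := by
    refine tendsto_const_nhds.add (Tendsto.const_mul _ ?_)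
    have := (tendsto_pow_atTop_nhds_zero_of_lt_one (r := (1 / 2 : ℝ)) (by norm_num)
      (by norm_num)).comp (tendsto_add_atTop_nat N)
    simpa only [Function.comp_def, add_comm N] using this
  rw [mul_zero, add_zero] at hlim
  refine ge_of_tendsto' hlim fun j => ?_
  have key := param_sub_param_le h0 h1 j (dyadicIndex_add_div s N j)
    ((dyadicIndex_add_div t N j).trans hst.symm) (dyadicIndex_mono (N + j) hle)
    (piece_subset_cap h0 h1 _ _ (hγ s (N + j))) (piece_subset_cap h0 h1 _ _ (hγ t (N + j)))
  have u1 := dyadicIndex_div_le hs (N + j)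
  have u2 := lt_dyadicIndex_add_one_div t (N + j)
  rw [add_div] at u2 key
  rw [one_div_pow]
  linarith

/-! ### Infinite Hausdorff measure -/

theorem volume_le_mul_hausdorffMeasure_image {γ : ℝ → Plane} {S : Set ℝ} {C : NNReal}
    (h : ∀ s ∈ S, ∀ t ∈ S, dist s t ≤ C * dist (γ s) (γ t)) :
    volume S ≤ C * μH[1] (γ '' S) := by
  have hinj : InjOn γ S := fun s hs t ht hst => by
    have := h s hs t ht
    rw [hst, dist_self, mul_zero] at this
    exact dist_le_zero.1 this
  have hlip : LipschitzOnWith C (Function.invFunOn γ S) (γ '' S) := by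
    refine LipschitzOnWith.of_dist_le_mul ?_
    rintro _ ⟨s, hs, rfl⟩ _ ⟨t, ht, rfl⟩
    rw [hinj.leftInvOn_invFunOn hs, hinj.leftInvOn_invFunOn ht]
    exact h s hs t ht
  have := hlip.hausdorffMeasure_image_le (d := 1) zero_le_one
  rwa [hinj.leftInvOn_invFunOn.image_image, hausdorffMeasure_real, ENNReal.rpow_one] at this

theorem aedisjoint_caps {ε : ℝ} (h0 : 0 < ε) (h1 : ε < 1 / 100) {N i j : ℕ} (hi : i < 2 ^ N)
    (hj : j < 2 ^ N) (hij : i ≠ j) : AEDisjoint (μH[1] : Measure Plane) (cap ε N i) (cap ε N j) := by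
  have := Measure.nullSingletonClass_hausdorff Plane (d := 1) one_pos
  refine measure_mono_null (t := {(edge ε N i).1, (edge ε N i).2}) (fun x hx => ?_)
    (((finite_singleton _).insert _).measure_zero _)
  exact isEndpoint_of_mem_caps h0 h1 hi hj hij hx.1 hx.2

/-- The set of parameters of the points of `E` has measure at most `2 * compConst ε N` times the
length of `E`, for every `N`. -/
theorem volume_param_le {ε : ℝ} (h0 : 0 < ε) (h1 : ε < 1 / 100) {γ : ℝ → Plane}
    (hγ : ∀ t n, γ t ∈ piece ε n (dyadicIndex t n)) {E : Set Plane} (hE : MeasurableSet E) (N : ℕ) :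
    volume {t ∈ Ico (0 : ℝ) 1 | γ t ∈ E} ≤ ENNReal.ofReal (2 * compConst ε N) * μH[1] E := by
  have hC := compConst_pos ε N
  have hcov : {t ∈ Ico (0 : ℝ) 1 | γ t ∈ E} ⊆
      ⋃ i ∈ Finset.range (2 ^ N), {t ∈ Ico (0 : ℝ) 1 | γ t ∈ E ∧ dyadicIndex t N = i} :=
    fun t ht => mem_biUnion (Finset.mem_coe.2 (Finset.mem_range.2 (dyadicIndex_lt ht.1 N)))
      ⟨ht.1, ht.2, rfl⟩
  calc volume {t ∈ Ico (0 : ℝ) 1 | γ t ∈ E}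
      ≤ ∑ i ∈ Finset.range (2 ^ N), volume {t ∈ Ico (0 : ℝ) 1 | γ t ∈ E ∧ dyadicIndex t N = i} :=
        (measure_mono hcov).trans (measure_biUnion_finset_le _ _)
    _ ≤ ∑ i ∈ Finset.range (2 ^ N), ENNReal.ofReal (2 * compConst ε N) * μH[1] (E ∩ cap ε N i) := by
        refine Finset.sum_le_sum fun i _ => ?_
        refine (volume_le_mul_hausdorffMeasure_image (γ := γ)
          (C := Real.toNNReal (2 * compConst ε N)) fun s hs t ht => ?_).trans ?_
        · rw [Real.coe_toNNReal _ (by positivity)]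
          exact dist_param_le h0 h1 hγ hs.1.1 ht.1.1 (hs.2.2.trans ht.2.2.symm)
        · refine mul_le_mul_right (measure_mono ?_) _
          rintro _ ⟨t, ht, rfl⟩
          exact ⟨ht.2.1, ht.2.2 ▸ piece_subset_cap h0 h1 _ _ (hγ t N)⟩
    _ = ENNReal.ofReal (2 * compConst ε N) *
          μH[1] (⋃ i ∈ Finset.range (2 ^ N), E ∩ cap ε N i) := by
        rw [← Finset.mul_sum, measure_biUnion_finset₀]
        · intro i hi j hj hij
          exact (aedisjoint_caps h0 h1 (Finset.mem_range.1 hi) (Finset.mem_range.1 hj) hij).mono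
            inter_subset_right inter_subset_right
        · exact fun i _ => (hE.inter (isClosed_cap ε N i).measurableSet).nullMeasurableSet
    _ ≤ _ := by
        gcongr
        exact iUnion₂_subset fun i _ => inter_subset_left

/-- Since `volume_param_le` holds with arbitrarily small constants, a set has infinite length if
its parameters have positive measure. -/
theorem hausdorffMeasure_eq_top {ε : ℝ} (h0 : 0 < ε) (h1 : ε < 1 / 100) {γ : ℝ → Plane}
    (hγ : ∀ t n, γ t ∈ piece ε n (dyadicIndex t n)) {E : Set Plane} (hE : MeasurableSet E)
    (hpos : volume {t ∈ Ico (0 : ℝ) 1 | γ t ∈ E} ≠ 0) : μH[1] E = ⊤ := by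
  by_contra hfin
  have hlim : Tendsto (fun N => ENNReal.ofReal (2 * compConst ε N) * μH[1] E) atTop (𝓝 0) := by
    have := ENNReal.tendsto_ofReal ((tendsto_compConst h0).const_mul 2)
    rw [mul_zero, ENNReal.ofReal_zero] at this
    simpa using ENNReal.Tendsto.mul_const this (Or.inr hfin)
  exact hpos (le_antisymm (ge_of_tendsto' hlim (volume_param_le h0 h1 hγ hE)) zero_le)

theorem radius_le_rho (ε : ℝ) (k : ℕ) : radius ε k ≤ rho ε k := by
  unfold radius
  split_ifs
  · exact le_rfl
  · exact min_le_left _ _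

theorem tsum_rho_lt {ε : ℝ} (h0 : 0 < ε) (h1 : ε < 1 / 100) :
    ∑' k : ℕ, ENNReal.ofReal (8 * rho ε (k + 1)) < 1 := by
  have hr : ∀ k : ℕ, 8 * rho ε (k + 1) =
      8 * (1 / 4 * (1 / 2 ^ 7) * √(1 + 7 * 16 * ε ^ 2)) * (1 / 4 : ℝ) ^ k := fun k => by
    rw [rho, show (1 : ℤ) - ((k + 1 : ℕ) : ℤ) = -(k : ℤ) by push_cast; ring, zpow_neg, zpow_natCast,
      one_div_pow, one_div]
    ring
  have hs : √(1 + 7 * 16 * ε ^ 2) ≤ 2 := Real.sqrt_le_iff.2 ⟨by norm_num, by nlinarith⟩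
  simp_rw [hr]
  rw [← ENNReal.ofReal_tsum_of_nonneg (fun k => by positivity)
    ((summable_geometric_of_lt_one (by norm_num) (by norm_num)).mul_left _), tsum_mul_left,
    tsum_geometric_of_lt_one (by norm_num) (by norm_num), ENNReal.ofReal_lt_one]
  norm_num at hs ⊢
  linarith

/-- The removed balls are so small that they leave a set of parameters of positive measure. -/
theorem volume_param_closedPseudoFractal {ε : ℝ} (h0 : 0 < ε) (h1 : ε < 1 / 100) {γ : ℝ → Plane}
    (hγ : ∀ t n, γ t ∈ piece ε n (dyadicIndex t n)) :
    volume {t ∈ Ico (0 : ℝ) 1 | γ t ∈ closedPseudoFractal ε} ≠ 0 := by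
  intro hzero
  set S : ℕ → Set ℝ := fun k =>
    {t ∈ Ico (0 : ℝ) 1 | γ t ∈ Metric.ball (edgePoint ε (k + 1)) (radius ε (k + 1))} with hS
  have hcov : Ico (0 : ℝ) 1 ⊆ {t ∈ Ico (0 : ℝ) 1 | γ t ∈ closedPseudoFractal ε} ∪ ⋃ k, S k := by
    intro t ht
    by_cases hb : γ t ∈ ⋃ k ∈ Ici 1, Metric.ball (edgePoint ε k) (radius ε k)
    · obtain ⟨k, hk, hb⟩ := mem_iUnion₂.1 hb
      obtain ⟨k, rfl⟩ := Nat.exists_eq_add_of_le' (mem_Ici.1 hk)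
      exact Or.inr (mem_iUnion.2 ⟨k, ht, hb⟩)
    · refine Or.inl ⟨ht, ?_⟩
      rw [closedPseudoFractal_eq h0 h1]
      exact ⟨by simpa [Nat.lt_one_iff.1 (dyadicIndex_lt ht 0)] using hγ t 0, hb⟩
  have hSk : ∀ k, volume (S k) ≤ ENNReal.ofReal (8 * rho ε (k + 1)) := fun k => by
    refine (Real.volume_le_diam _).trans (Metric.ediam_le_of_forall_dist_le fun s hs t ht => ?_)
    have h00 : dyadicIndex s 0 = dyadicIndex t 0 := by
      rw [Nat.lt_one_iff.1 (dyadicIndex_lt hs.1 0), Nat.lt_one_iff.1 (dyadicIndex_lt ht.1 0)]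
    have hd := dist_param_le h0 h1 hγ hs.1.1 ht.1.1 h00
    have hc : compConst ε 0 = 2 := by simp [compConst]
    rw [hc] at hd
    have a1 := Metric.mem_ball.1 hs.2
    have a2 := Metric.mem_ball.1 ht.2
    linarith [radius_le_rho ε (k + 1), dist_triangle_right (γ s) (γ t) (edgePoint ε (k + 1))]
  have : volume (Ico (0 : ℝ) 1) < 1 :=
    calc volume (Ico (0 : ℝ) 1) ≤ 0 + ∑' k, volume (S k) := by
          rw [← hzero]
          exact (measure_mono hcov).trans ((measure_union_le _ _).trans
            (add_le_add_right (measure_iUnion_le _) _))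
      _ ≤ ∑' k : ℕ, ENNReal.ofReal (8 * rho ε (k + 1)) := by
          rw [zero_add]; exact ENNReal.tsum_le_tsum hSk
      _ < 1 := tsum_rho_lt h0 h1
  simp at this

theorem hausdorffMeasure_closedPseudoFractal {ε : ℝ} (h0 : 0 < ε) (h1 : ε < 1 / 100) :
    μH[1] (closedPseudoFractal ε) = ⊤ := by
  obtain ⟨γ, hγ⟩ := exists_parametrization h0 h1
  exact hausdorffMeasure_eq_top h0 h1 hγ (isCompact_closedPseudoFractal h0 h1).measurableSet
    (volume_param_closedPseudoFractal h0 h1 hγ)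

/-- By compactness, the infinite length is concentrated at a point. -/
theorem exists_point_of_infinite_measure {ε : ℝ} (h0 : 0 < ε) (h1 : ε < 1 / 100) :
    ∃ y ∈ closedPseudoFractal ε, ∀ r > 0, μH[1] (closedPseudoFractal ε ∩ Metric.ball y r) = ⊤ := by
  by_contra! hcon
  refine ((isCompact_closedPseudoFractal h0 h1).measure_lt_top_of_nhdsWithin (μ := μH[1])
    fun y hy => ?_).ne (hausdorffMeasure_closedPseudoFractal h0 h1)
  obtain ⟨r, hr, h⟩ := hcon y hy
  exact ⟨_, inter_mem_nhdsWithin _ (Metric.ball_mem_nhds y hr), h.lt_top⟩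

theorem not_weakLocallyFiniteHausdorff_of_subset {A B : Set Plane} (hBA : B ⊆ A) {y : Plane}
    (hy : y ∈ B) (h : ∀ r > 0, μH[1] (B ∩ Metric.ball y r) = ⊤) :
    ¬ WeakLocallyFiniteHausdorff 1 A := by
  intro hA
  obtain ⟨r, hr, hfin⟩ := hA y (hBA hy)
  rw [Nat.cast_one] at hfin
  refine hfin.not_ge ((h r hr).symm.trans_le (measure_mono ?_))
  rw [inter_comm]
  exact inter_subset_inter_right _ hBA

theorem hasOneDensity_top {A : Set Plane} {y : Plane}
    (h : ∀ r > 0, μH[1] (A ∩ Metric.ball y r) = ⊤) : HasOneDensity A y ⊤ := by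
  refine tendsto_const_nhds.congr' ?_
  filter_upwards [self_mem_nhdsWithin] with r hr
  rw [h r hr, ENNReal.top_div_of_ne_top ENNReal.ofReal_ne_top]

end PseudoFractal

end

theorem theorem3 :
    (∀ ε : ℝ, 0 < ε → ε < 1 / 100 →
      (PseudoFractal.FineWeakApproxLocUnif 1 (PseudoFractal.pseudoFractal ε) ∧
        PseudoFractal.SimonApprox 1 (PseudoFractal.pseudoFractal ε) ∧
        ¬ PseudoFractal.WeakLocallyFiniteHausdorff 1 (PseudoFractal.pseudoFractal ε)) ∧
      (PseudoFractal.closedPseudoFractal ε ⊆ PseudoFractal.pseudoFractal ε ∧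
        IsClosed (PseudoFractal.closedPseudoFractal ε) ∧
        PseudoFractal.FineWeakApproxLocUnif 1 (PseudoFractal.closedPseudoFractal ε) ∧
        PseudoFractal.SimonApprox 1 (PseudoFractal.closedPseudoFractal ε) ∧
        ¬ PseudoFractal.WeakLocallyFiniteHausdorff 1 (PseudoFractal.closedPseudoFractal ε) ∧
        μH[1] (PseudoFractal.closedPseudoFractal ε) = ⊤ ∧
        ∃ y ∈ PseudoFractal.closedPseudoFractal ε,
          PseudoFractal.HasOneDensity (PseudoFractal.closedPseudoFractal ε) y ⊤)) ∧
    (¬ ∀ A : Set (EuclideanSpace ℝ (Fin 2)), PseudoFractal.FineWeakApproxLocUnif 1 A →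
        PseudoFractal.WeakLocallyFiniteHausdorff 1 A) ∧
    (¬ ∀ A : Set (EuclideanSpace ℝ (Fin 2)), PseudoFractal.FineWeakApproxLocUnif 1 A →
        PseudoFractal.LocallyFiniteHausdorff 1 A) ∧
    (¬ ∀ A : Set (EuclideanSpace ℝ (Fin 2)), IsClosed A →
        PseudoFractal.FineWeakApproxLocUnif 1 A →
        PseudoFractal.WeakLocallyFiniteHausdorff 1 A) ∧
    (¬ ∀ A : Set (EuclideanSpace ℝ (Fin 2)), IsClosed A →
        PseudoFractal.FineWeakApproxLocUnif 1 A →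
        PseudoFractal.LocallyFiniteHausdorff 1 A) := by
  open PseudoFractal in
  have main : ∀ ε : ℝ, 0 < ε → ε < 1 / 100 →
      (FineWeakApproxLocUnif 1 (pseudoFractal ε) ∧ SimonApprox 1 (pseudoFractal ε) ∧
        ¬ WeakLocallyFiniteHausdorff 1 (pseudoFractal ε)) ∧
      (closedPseudoFractal ε ⊆ pseudoFractal ε ∧ IsClosed (closedPseudoFractal ε) ∧
        FineWeakApproxLocUnif 1 (closedPseudoFractal ε) ∧ SimonApprox 1 (closedPseudoFractal ε) ∧
        ¬ WeakLocallyFiniteHausdorff 1 (closedPseudoFractal ε) ∧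
        μH[1] (closedPseudoFractal ε) = ⊤ ∧
        ∃ y ∈ closedPseudoFractal ε, HasOneDensity (closedPseudoFractal ε) y ⊤) := by
    intro ε h0 h1
    have hsub : closedPseudoFractal ε ⊆ pseudoFractal ε := sdiff_subset
    have hS := simonApprox_pseudoFractal h0 h1
    have hS' := hS.mono hsub
    obtain ⟨y, hy, hinf⟩ := exists_point_of_infinite_measure h0 h1
    exact ⟨⟨hS.fineWeakApproxLocUnif, hS, not_weakLocallyFiniteHausdorff_of_subset hsub hy hinf⟩,
      hsub, (isCompact_closedPseudoFractal h0 h1).isClosed, hS'.fineWeakApproxLocUnif, hS',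
      not_weakLocallyFiniteHausdorff_of_subset Subset.rfl hy hinf,
      hausdorffMeasure_closedPseudoFractal h0 h1, y, hy, hasOneDensity_top hinf⟩
  have e0 : (0 : ℝ) < 1 / 200 := by norm_num
  have e1 : (1 / 200 : ℝ) < 1 / 100 := by norm_num
  obtain ⟨-, -, hcl, hF, -, hW, htop, -⟩ := main _ e0 e1
  have hL : ¬ PseudoFractal.LocallyFiniteHausdorff 1 (PseudoFractal.closedPseudoFractal (1 / 200)) :=
    fun h => by
      have := h _ (PseudoFractal.isCompact_closedPseudoFractal e0 e1)
      rw [inter_self, Nat.cast_one, htop] at this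
      exact lt_irrefl _ this
  exact ⟨main, fun h => hW (h _ hF), fun h => hL (h _ hF), fun h => hW (h _ hcl hF),
    fun h => hL (h _ hcl hF)⟩
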